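/- Let $P\subset\mathbb{R}^n$ be a simple $n$-dimensional convex polytope, and let $X=X^n$ be an orientable small cover over $P$: a smooth orientable $n$-manifold with a smooth, locally standard action of $\mathbb{Z}_2^n$ (around every point it is, up to an automorphism of $\mathbb{Z}_2^n$, equivariantly diffeomorphic to an invariant open subset of $\mathbb{R}^n$ on which $\mathbb{Z}_2^n$ acts by sign changes of the coordinates), together with a diffeomorphism of manifolds with corners $X/\mathbb{Z}_2^n\cong P$. Let $G\subset\mathbb{Z}_2^n$ be the $2$-subtorus in general position, that is, the subgroup of index $2$ such that at every fixed point $x$ of the restricted $G$-action any $n-1$ of the $n$ weights $\alpha_{x,1},\dots,\alpha_{x,n}\in\operatorname{Hom}(G,\mathbb{Z}_2)$ of the tangent representation of $G$ on $T_xX$ are linearly independent over $\mathbb{Z}_2$. Then the orbit space $X/G$ is homeomorphic to the $n$-dimensional sphere $S^n$. More precisely, $X/G$ is homeomorphic to two copies of $P$ glued along $\partial P$, that is, to $(P\times\mathbb{Z}_2)/\!\sim$ where $(x,0)\sim(x,1)$ for $x\in\partial P$, by a homeomorphism that is compatible with the projections $X/G\to X/\mathbb{Z}_2^n\cong P$ and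 $(P\times\mathbb{Z}_2)/\!\sim\;\to P$. -/

import Mathlib

open scoped Manifold ContDiff Topology

noncomputable section

namespace SmallCover

/-- The `2`-torus `ℤ₂ⁿ`, written additively. -/
abbrev TwoTorus (n : ℕ) : Type := Fin n → ZMod 2

/-- The space `ℝⁿ` with its Euclidean norm. -/
abbrev Euc (n : ℕ) : Type := EuclideanSpace ℝ (Fin n)

/-! ### Simple polytopes -/

/-- An `n`-dimensional convex polytope in `ℝⁿ`: the convex hull of finitely many points, with
nonempty interior. -/
def IsPolytope {n : ℕ} (P : Set (Euc n)) : Prop :=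
  (∃ V : Finset (Euc n), P = convexHull ℝ (V : Set (Euc n))) ∧ (interior P).Nonempty

/-- A facet of `P`: a nonempty (exposed) face of dimension `n - 1`. -/
def IsFacet {n : ℕ} (P F : Set (Euc n)) : Prop :=
  F.Nonempty ∧ IsExposed ℝ P F ∧ Module.finrank ℝ (vectorSpan ℝ F) + 1 = n

/-- A simple `n`-polytope: every vertex lies in exactly `n` facets. -/
def IsSimplePolytope {n : ℕ} (P : Set (Euc n)) : Prop :=
  IsPolytope P ∧ ∀ v ∈ Set.extremePoints ℝ P, {F | IsFacet P F ∧ v ∈ F}.encard = n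

/-! ### The double of a polytope -/

/-- The relation on `P × {0, 1}` that identifies `(x, 0)` with `(x, 1)` for `x ∈ ∂P`. -/
def doubleSetoid {n : ℕ} (P : Set (Euc n)) : Setoid (P × Bool) where
  r a b := a.1 = b.1 ∧ (a.2 = b.2 ∨ (a.1 : Euc n) ∈ frontier P)
  iseqv :=
    { refl := fun _ => ⟨rfl, Or.inl rfl⟩
      symm := by
        rintro ⟨x, s⟩ ⟨y, t⟩ ⟨h, h'⟩
        dsimp only at h h'
        subst h
        exact ⟨rfl, h'.imp Eq.symm id⟩
      trans := by
        rintro ⟨x, s⟩ ⟨y, t⟩ ⟨z, u⟩ ⟨h, h'⟩ ⟨k, k'⟩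
        dsimp only at h h' k k'
        subst h
        subst k
        refine ⟨rfl, ?_⟩
        rcases h' with h' | h'
        · rcases k' with k' | k'
          · exact Or.inl (h'.trans k')
          · exact Or.inr k'
        · exact Or.inr h' }

/-- Two copies of `P` glued along `∂P`, with the quotient topology. -/
abbrev Double {n : ℕ} (P : Set (Euc n)) : Type := Quotient (doubleSetoid P)

/-- The folding map from the double of `P` onto `P`. -/
def Double.fold {n : ℕ} {P : Set (Euc n)} : Double P → P :=
  Quotient.lift Prod.fst fun _ _ h => h.1

/-! ### Orientability -/

/-- A smooth `n`-manifold is orientable if it is covered by charts of its smooth structure all of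
whose transition maps have positive Jacobian determinant. -/
def IsOrientable (n : ℕ) (X : Type*) [TopologicalSpace X] [ChartedSpace (Euc n) X] : Prop :=
  ∃ A ⊆ IsManifold.maximalAtlas (𝓡 n) ∞ X,
    (∀ x : X, ∃ φ ∈ A, x ∈ φ.source) ∧
    ∀ φ ∈ A, ∀ ψ ∈ A, ∀ z ∈ (φ.symm.trans ψ).source, 0 < (fderiv ℝ (ψ ∘ φ.symm) z).det

/-! ### Small covers -/

/-- The real sign `(-1)^a` of an element `a` of `ℤ₂`. -/
def sign (a : ZMod 2) : ℝ := if a = 0 then 1 else -1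

/-- The standard action of `ℤ₂ⁿ` on `ℝⁿ` by sign changes of the coordinates. -/
def stdAct {n : ℕ} (t : TwoTorus n) (z : Euc n) : Euc n :=
  WithLp.toLp 2 fun i => sign (t i) * z i

/-- The orbit map of the standard action, `z ↦ (z₁², …, zₙ²)`. It identifies `ℝⁿ / ℤ₂ⁿ` with the
orthant of all vectors with nonnegative coordinates. -/
def squares {n : ℕ} (z : Euc n) : Euc n :=
  WithLp.toLp 2 fun i => z i ^ 2

/-- A standard chart: a diffeomorphism from an invariant open set onto an open set in `ℝⁿ` that is
equivariant with respect to the standard action, up to an automorphism of `ℤ₂ⁿ`. -/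
def IsStandardChart {n : ℕ} {X : Type*} [TopologicalSpace X] [ChartedSpace (Euc n) X]
    [AddAction (TwoTorus n) X] (φ : OpenPartialHomeomorph X (Euc n)) : Prop :=
  φ ∈ IsManifold.maximalAtlas (𝓡 n) ∞ X ∧
    ∃ θ : TwoTorus n ≃+ TwoTorus n, ∀ y ∈ φ.source, ∀ g : TwoTorus n,
      g +ᵥ y ∈ φ.source ∧ φ (g +ᵥ y) = stdAct (θ g) (φ y)

/-- `e : X / ℤ₂ⁿ ≃ P` is a diffeomorphism of manifolds with corners. A standard chart `φ` of `X`
induces the corner chart `[y] ↦ squares (φ y)` of `X / ℤ₂ⁿ`, whose image is open in the orthant;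
`F` is `e` read in this chart, and `H` is the inverse of `e` read in this chart. -/
def IsCornerDiffeo {n : ℕ} {X : Type*} [TopologicalSpace X] [ChartedSpace (Euc n) X]
    [AddAction (TwoTorus n) X] {P : Set (Euc n)}
    (e : AddAction.orbitRel.Quotient (TwoTorus n) X ≃ₜ P) : Prop :=
  ∀ x : X, ∃ φ : OpenPartialHomeomorph X (Euc n), IsStandardChart φ ∧ x ∈ φ.source ∧
    ∃ F H : Euc n → Euc n,
      ContDiffOn ℝ ∞ F (squares '' φ.target) ∧
      ContDiffOn ℝ ∞ H ((fun y : X => (e (Quotient.mk _ y) : Euc n)) '' φ.source) ∧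
      ∀ y ∈ φ.source,
        (e (Quotient.mk _ y) : Euc n) = F (squares (φ y)) ∧
        H (e (Quotient.mk _ y) : Euc n) = squares (φ y)

/-- The smooth manifold `X` with the given action of `ℤ₂ⁿ` is a small cover over the simple
polytope `P`, where `e` identifies the orbit space with `P`. -/
structure IsSmallCover {n : ℕ} {X : Type*} [TopologicalSpace X] [ChartedSpace (Euc n) X]
    [AddAction (TwoTorus n) X] (P : Set (Euc n))
    (e : AddAction.orbitRel.Quotient (TwoTorus n) X ≃ₜ P) : Prop where
  simple : IsSimplePolytope P
  smooth : ∀ g : TwoTorus n, ContMDiff (𝓡 n) (𝓡 n) ∞ (fun x : X => g +ᵥ x)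
  locallyStandard : ∀ x : X, ∃ φ : OpenPartialHomeomorph X (Euc n),
    IsStandardChart φ ∧ x ∈ φ.source
  diffeo : IsCornerDiffeo e

/-! ### Subtori in general position -/

/-- `α₁, …, αₙ ∈ Hom(G, ℤ₂)` are the weights of the tangent representation of `G` at its fixed
point `x`: in some basis `b₁, …, bₙ` of `T_x X` every `g ∈ G` acts by `bᵢ ↦ (-1)^{αᵢ(g)} bᵢ`. -/
def IsWeights {n : ℕ} {X : Type*} [TopologicalSpace X] [ChartedSpace (Euc n) X]
    [AddAction (TwoTorus n) X] (G : AddSubgroup (TwoTorus n)) (x : X)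
    (α : Fin n → (G →+ ZMod 2)) : Prop :=
  ∃ b : Module.Basis (Fin n) ℝ (TangentSpace (𝓡 n) x), ∀ (g : G) (i : Fin n),
    (mfderiv (𝓡 n) (𝓡 n) (fun y : X => g +ᵥ y) x (b i) : Euc n) = sign (α i g) • b i

/-- The subgroup `G` of `ℤ₂ⁿ` is a `2`-subtorus of `X` in general position: it has index `2`, and
at each of its fixed points any `n - 1` of the `n` weights of the tangent representation are
linearly independent over `ℤ₂`. -/
def IsSubtorusInGeneralPosition {n : ℕ} (X : Type*) [TopologicalSpace X] [ChartedSpace (Euc n) X]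
    [AddAction (TwoTorus n) X] (G : AddSubgroup (TwoTorus n)) : Prop :=
  G.index = 2 ∧
    ∀ x : X, (∀ g : G, g +ᵥ x = x) → ∀ α : Fin n → (G →+ ZMod 2), IsWeights G x α →
      ∀ i₀ : Fin n, LinearIndependent (ZMod 2) fun j : {j : Fin n // j ≠ i₀} => α j

end SmallCover

end

/-! Over the interior of P the whole 2-torus acts freely, and the interior is contractible, so the
projection X → P has a section σ there (`exists_section`). Every point over an interior p is g +
σ(p) for a unique g, and the class of g modulo G, one of two values, selects a sheet of the double.
A point over ∂P is fixed by some element outside G, so there the G-orbits are the full orbits, just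
as the two sheets are glued. This gives a continuous bijection from the compact space X/G onto the
Hausdorff double (`exists_homeomorph_double`). A convex body with its boundary is a ball with its
sphere, so the double is two hemispheres glued along the equator.

Two facts about stabilizers remain. First, interior points of P must be exactly those over which no
chart coordinate vanishes. The differential of a corner chart identifies the tangent space of a
stratum with the lineality space of P at the image point (`IsCornerChart.finrank_lineality`). This
rests on `mem_lineality_of_hasDerivAt`, where polyhedrality enters: in a round body, curves along
the boundary have velocities outside the lineality space.

Second, over ∂P some stabilizer element lies outside G (`IsSmallCover.exists_notMem_vadd_eq_self`).
Some chart coordinate vanishes at x, and the corresponding reflection g fixes x. Suppose g ∈ G. On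
the closed set of points near which the stabilizer {0, g} occurs, a point of maximal norm in P is
fixed by the entire torus. There the weights of G are the chart coordinates and g is a coordinate
vector, so the functional with kernel G does not involve that coordinate. Restricted to G, it is a
relation among the other n - 1 weights; by independence it is zero, contradicting index 2. -/

noncomputable section

namespace SmallCover

/-! ### Feasible directions and lineality spaces of polytopes -/

section Polytope

variable {E : Type*} [NormedAddCommGroup E] [NormedSpace ℝ E]

/-- The cone of feasible directions of `P` at `p`. -/
def feasibleCone (P : Set E) (p : E) : Set E := {l | ∃ t : ℝ, 0 < t ∧ p + t • l ∈ P}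

theorem add_smul_mem_of_le {P : Set E} (hP : Convex ℝ P) {p l : E} (hp : p ∈ P) {s t : ℝ}
    (h : p + t • l ∈ P) (hs : 0 ≤ s) (hst : s ≤ t) : p + s • l ∈ P := by
  rcases hs.eq_or_lt with rfl | hs
  · simpa using hp
  have ht : 0 < t := hs.trans_le hst
  have := hP.add_smul_sub_mem hp h (t := s / t) ⟨by positivity, (div_le_one ht).2 hst⟩
  simpa [smul_smul, div_mul_cancel₀ _ ht.ne'] using this

theorem smul_mem_feasibleCone {P : Set E} {p l : E} (h : l ∈ feasibleCone P p) {c : ℝ}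
    (hc : 0 < c) : c • l ∈ feasibleCone P p := by
  obtain ⟨t, ht, h⟩ := h
  refine ⟨t / c, by positivity, ?_⟩
  rwa [smul_smul, div_mul_cancel₀ _ hc.ne']

theorem add_mem_feasibleCone {P : Set E} (hP : Convex ℝ P) {p : E} (hp : p ∈ P) {l m : E}
    (hl : l ∈ feasibleCone P p) (hm : m ∈ feasibleCone P p) : l + m ∈ feasibleCone P p := by
  obtain ⟨s, hs, hl⟩ := hl
  obtain ⟨t, ht, hm⟩ := hm
  have hr : 0 < min s t := lt_min hs ht
  refine ⟨min s t / 2, by positivity, ?_⟩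
  have h1 := add_smul_mem_of_le hP hp hl hr.le (min_le_left s t)
  have h2 := add_smul_mem_of_le hP hp hm hr.le (min_le_right s t)
  have := hP.midpoint_mem h1 h2
  convert this using 1
  rw [midpoint_eq_smul_add, invOf_eq_inv]
  module

theorem zero_mem_feasibleCone {P : Set E} {p : E} (hp : p ∈ P) : (0 : E) ∈ feasibleCone P p :=
  ⟨1, one_pos, by simpa using hp⟩

theorem sub_mem_feasibleCone {P : Set E} {p q : E} (hq : q ∈ P) : q - p ∈ feasibleCone P p :=
  ⟨1, one_pos, by simpa using hq⟩

/-- The lineality space of the cone of feasible directions of a convex set. -/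
def lineality {P : Set E} (hP : Convex ℝ P) {p : E} (hp : p ∈ P) : Submodule ℝ E where
  carrier := {l | l ∈ feasibleCone P p ∧ -l ∈ feasibleCone P p}
  zero_mem' := ⟨zero_mem_feasibleCone hp, by simpa using zero_mem_feasibleCone hp⟩
  add_mem' := by
    rintro l m ⟨hl, hl'⟩ ⟨hm, hm'⟩
    refine ⟨add_mem_feasibleCone hP hp hl hm, ?_⟩
    rw [neg_add]
    exact add_mem_feasibleCone hP hp hl' hm'
  smul_mem' := by
    rintro c l ⟨hl, hl'⟩
    rcases lt_trichotomy c 0 with hc | rfl | hc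
    · have h1 := smul_mem_feasibleCone hl (neg_pos.2 hc)
      have h2 := smul_mem_feasibleCone hl' (neg_pos.2 hc)
      refine ⟨by simpa using h2, by simpa using h1⟩
    · simpa using zero_mem_feasibleCone hp
    · exact ⟨smul_mem_feasibleCone hl hc, by simpa using smul_mem_feasibleCone hl' hc⟩

theorem mem_lineality {P : Set E} (hP : Convex ℝ P) {p : E} (hp : p ∈ P) {l : E} :
    l ∈ lineality hP hp ↔ l ∈ feasibleCone P p ∧ -l ∈ feasibleCone P p := Iff.rfl

theorem exists_forall_mem_of_mem_lineality {P : Set E} (hP : Convex ℝ P) {p : E} (hp : p ∈ P)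
    {l : E} (hl : l ∈ lineality hP hp) : ∃ ε > 0, ∀ t : ℝ, |t| ≤ ε → p + t • l ∈ P := by
  obtain ⟨⟨s, hs, h1⟩, t, ht, h2⟩ := hl
  refine ⟨min s t, lt_min hs ht, fun r hr => ?_⟩
  have hr1 := hr.trans (min_le_left _ _)
  have hr2 := hr.trans (min_le_right _ _)
  rcases le_total 0 r with h | h
  · rw [abs_of_nonneg h] at hr1
    exact add_smul_mem_of_le hP hp h1 h hr1
  · rw [abs_of_nonpos h] at hr2
    have := add_smul_mem_of_le hP hp h2 (neg_nonneg.2 h) hr2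
    simpa using this

/-- A point of an open segment in `P` has at least the feasible directions of the endpoints. -/
theorem feasibleCone_subset_of_mem_openSegment {P : Set E} (hP : Convex ℝ P) {p q r : E}
    (hr : r ∈ P) (hq : q ∈ openSegment ℝ p r) : feasibleCone P p ⊆ feasibleCone P q := by
  rintro l ⟨t, ht, hl⟩
  obtain ⟨a, b, ha, hb, hab, rfl⟩ := hq
  refine ⟨a * t, by positivity, ?_⟩
  have := hP hl hr ha.le hb.le hab
  convert this using 1
  module

/-- Each of the two points lies in an open segment of P issuing from the other one, so their
feasible cones contain each other. -/
theorem lineality_add_smul {P : Set E} (hP : Convex ℝ P) {p : E} (hp : p ∈ P)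
    {l : E} {ε t : ℝ} (hε : ∀ t : ℝ, |t| ≤ ε → p + t • l ∈ P) (ht : |t| < ε)
    (hq : p + t • l ∈ P) : lineality hP hq = lineality hP hp := by
  have key : feasibleCone P (p + t • l) = feasibleCone P p := by
    rcases eq_or_ne t 0 with rfl | h0
    · simp
    have h0' : 0 < |t| := abs_pos.2 h0
    have hε0 : 0 < ε := h0'.trans ht
    apply Set.Subset.antisymm
    · refine feasibleCone_subset_of_mem_openSegment (r := p + (-t) • l) hP
        (hε _ (by rw [abs_neg]; exact ht.le)) ?_
      refine ⟨1 / 2, 1 / 2, by norm_num, by norm_num, by norm_num, by module⟩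
    · refine feasibleCone_subset_of_mem_openSegment (r := p + (ε / |t| * t) • l) hP (hε _ ?_) ?_
      · rw [abs_mul, abs_div, abs_abs, div_mul_cancel₀ _ h0'.ne', abs_of_pos hε0]
      · refine ⟨1 - |t| / ε, |t| / ε, ?_, by positivity, by ring, ?_⟩
        · rw [sub_pos, div_lt_one hε0]
          exact ht
        · have : |t| / ε * (ε / |t| * t) = t := by field_simp
          rw [smul_add, smul_smul, this]
          module
  ext m
  rw [mem_lineality, mem_lineality, key]

/-- If every direction is feasible, a segment from an interior point to p can be prolonged beyond p
inside P, which makes p interior. This turns interiority into a statement about dimension. -/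
theorem lineality_eq_top_iff {P : Set E} (hP : Convex ℝ P) (hne : (interior P).Nonempty) {p : E}
    (hp : p ∈ P) : lineality hP hp = ⊤ ↔ p ∈ interior P := by
  constructor
  · intro h
    obtain ⟨q, hq⟩ := hne
    obtain ⟨-, t, ht, hr⟩ : q - p ∈ lineality hP hp := by rw [h]; trivial
    refine hP.openSegment_interior_self_subset_interior hq hr ?_
    have : 0 < 1 + t := by positivity
    refine ⟨t / (1 + t), 1 / (1 + t), by positivity, by positivity, by field_simp; ring, ?_⟩
    have h1 : (1 / (1 + t)) * t = t / (1 + t) := by ring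
    have h2 : t / (1 + t) + 1 / (1 + t) = 1 := by field_simp; ring
    calc (t / (1 + t)) • q + (1 / (1 + t)) • (p + t • -(q - p))
        = (t / (1 + t)) • q + (1 / (1 + t)) • p + ((1 / (1 + t)) * t) • (p - q) := by module
      _ = (t / (1 + t) + 1 / (1 + t)) • p := by rw [h1]; module
      _ = p := by rw [h2, one_smul]
  · intro h
    have key : ∀ l : E, l ∈ feasibleCone P p := by
      intro l
      have h1 : ContinuousAt (fun t : ℝ => p + t • l) 0 := by fun_prop
      have h2 : ∀ᶠ t in 𝓝 (0 : ℝ), p + t • l ∈ P :=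
        h1.eventually (by simpa using mem_interior_iff_mem_nhds.1 h)
      obtain ⟨ε, hε, h3⟩ := Metric.eventually_nhds_iff.1 h2
      exact ⟨ε / 2, by positivity, h3 (by
        rw [Real.dist_eq, sub_zero, abs_of_pos (by positivity)]; linarith)⟩
    exact eq_top_iff.2 fun l _ => ⟨key l, key (-l)⟩

variable {F : Type*} [NormedAddCommGroup F] [NormedSpace ℝ F]

/-- The lineality space of a polytope at `p` is exposed, with a linear bound on the distance to
it. The map `π` should be thought of as a projection with kernel the lineality space. -/
theorem exists_exposing_functional (V : Finset E) {p : E}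
    (hp : p ∈ convexHull ℝ (V : Set E)) (hfin : FiniteDimensional ℝ E) (π : E →L[ℝ] F)
    (hπ : ∀ l ∈ lineality (convex_convexHull ℝ (V : Set E)) hp, π l = 0) :
    ∃ (f : E →L[ℝ] ℝ) (R : ℝ), ∀ q ∈ convexHull ℝ (V : Set E),
      0 ≤ f (q - p) ∧ ‖π (q - p)‖ ≤ R * f (q - p) := by
  classical
  set P := convexHull ℝ (V : Set E)
  have hP : Convex ℝ P := convex_convexHull ℝ _
  set L := lineality hP hp
  -- The feasible directions outside the lineality space form a convex set. Hence the hull of the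
  -- generators v - p outside L misses L and can be strictly separated from it.
  set N : Set E := {x | x ∈ feasibleCone P p ∧ -x ∉ feasibleCone P p}
  have hN : Convex ℝ N := by
    intro x hx y hy a b ha hb hab
    rcases ha.eq_or_lt with rfl | ha
    · rw [zero_add] at hab
      simpa [hab] using hy
    rcases hb.eq_or_lt with rfl | hb
    · rw [add_zero] at hab
      simpa [hab] using hx
    refine ⟨add_mem_feasibleCone hP hp (smul_mem_feasibleCone hx.1 ha)
      (smul_mem_feasibleCone hy.1 hb), fun h => hx.2 ?_⟩
    have h1 := smul_mem_feasibleCone (add_mem_feasibleCone hP hp h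
      (smul_mem_feasibleCone hy.1 hb)) (inv_pos.2 ha)
    convert h1 using 1
    rw [neg_add_rev, add_comm (-(b • y)), neg_add_cancel_right, smul_neg, smul_smul,
      inv_mul_cancel₀ ha.ne', one_smul]
  have hVP : ∀ v ∈ V, v ∈ P := fun v hv => subset_convexHull ℝ _ hv
  set W : Finset E := (V.image (· - p)).filter (· ∉ L)
  have hWN : (W : Set E) ⊆ N := by
    intro w hw
    obtain ⟨hw, hwL⟩ := Finset.mem_filter.1 hw
    obtain ⟨v, hv, rfl⟩ := Finset.mem_image.1 hw
    have := sub_mem_feasibleCone (p := p) (hVP v hv)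
    exact ⟨this, fun h => hwL ⟨this, h⟩⟩
  have hdisj : Disjoint (convexHull ℝ (W : Set E)) (L : Set E) := by
    rw [Set.disjoint_left]
    intro x hx hxL
    exact (convexHull_min hWN hN hx).2 hxL.2
  obtain ⟨g, u, v, hg1, huv, hg2⟩ := geometric_hahn_banach_compact_closed (convex_convexHull ℝ _)
    (W.finite_toSet.isCompact_convexHull (𝕜 := ℝ)) L.convex L.closed_of_finiteDimensional hdisj
  have hv0 : v < 0 := by simpa using hg2 0 L.zero_mem
  -- A functional bounded below on a subspace vanishes on it.
  have hgL : ∀ l ∈ L, g l = 0 := by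
    intro l hl
    by_contra hne
    have := hg2 ((v / g l) • l) (L.smul_mem _ hl)
    rw [map_smul, smul_eq_mul, div_mul_cancel₀ _ hne] at this
    exact lt_irrefl _ this
  -- The sum dominates each ratio. The desired bounds hold at the points of V and define a convex
  -- set, so they pass to the hull.
  set R : ℝ := ∑ w ∈ W, ‖π w‖ / (-g w)
  have hWpos : ∀ w ∈ W, 0 < -g w := by
    intro w hw
    have := hg1 w (subset_convexHull ℝ _ hw)
    linarith
  have hC : Convex ℝ {x : E | 0 ≤ (-g) x ∧ ‖π x‖ ≤ R * (-g) x} := by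
    intro x hx y hy a b ha hb hab
    obtain ⟨hx1, hx2⟩ := hx
    obtain ⟨hy1, hy2⟩ := hy
    refine ⟨?_, ?_⟩
    · rw [map_add, map_smul, map_smul, smul_eq_mul, smul_eq_mul]
      positivity
    · rw [map_add, map_smul, map_smul, map_add, map_smul, map_smul, smul_eq_mul, smul_eq_mul]
      refine (norm_add_le _ _).trans ?_
      rw [norm_smul, norm_smul, Real.norm_of_nonneg ha, Real.norm_of_nonneg hb]
      have h1 := mul_le_mul_of_nonneg_left hx2 ha
      have h2 := mul_le_mul_of_nonneg_left hy2 hb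
      linarith
  have hC' : Convex ℝ {q : E | 0 ≤ (-g) (q - p) ∧ ‖π (q - p)‖ ≤ R * (-g) (q - p)} := by
    have := hC.translate_preimage_left (-p)
    convert this using 1
    ext q
    simp only [Set.mem_preimage, Set.mem_ofPred_eq, ← sub_eq_add_neg]
  refine ⟨-g, R, fun q hq => ?_⟩
  refine convexHull_min (fun v hv => ?_) hC' hq
  by_cases hL : v - p ∈ L
  · rw [Set.mem_ofPred_eq, hπ _ hL, neg_apply, hgL _ hL]
    simp
  · have hw : v - p ∈ W := Finset.mem_filter.2 ⟨Finset.mem_image_of_mem _ hv, hL⟩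
    refine ⟨(hWpos _ hw).le, ?_⟩
    have : ‖π (v - p)‖ / (-g (v - p)) ≤ R :=
      Finset.single_le_sum (f := fun w => ‖π w‖ / (-g w))
        (fun w hw => div_nonneg (norm_nonneg _) (hWpos w hw).le) hw
    exact (div_le_iff₀ (hWpos _ hw)).1 this

/-- A differentiable curve that stays in a polytope has velocities in the lineality space. -/
theorem mem_lineality_of_hasDerivAt {n : ℕ} (V : Finset (Euc n)) {p : Euc n}
    (hp : p ∈ convexHull ℝ (V : Set (Euc n))) {γ : ℝ → Euc n} {l : Euc n} (hγ : HasDerivAt γ l 0)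
    (h0 : γ 0 = p) (hmem : ∀ᶠ t in 𝓝 (0 : ℝ), γ t ∈ convexHull ℝ (V : Set (Euc n))) :
    l ∈ lineality (convex_convexHull ℝ (V : Set (Euc n))) hp := by
  set L := lineality (convex_convexHull ℝ (V : Set (Euc n))) hp
  obtain ⟨f, R, hfR⟩ := exists_exposing_functional V hp inferInstance (Lᗮ.starProjection)
    fun l hl => (Submodule.starProjection_apply_eq_zero_iff _).2
      ((Submodule.le_orthogonal_orthogonal L) hl)
  have hf : HasDerivAt (fun t => f (γ t - p)) (f l) 0 :=
    f.hasFDerivAt.comp_hasDerivAt 0 (hγ.sub_const p)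
  have hπ : HasDerivAt (fun t => Lᗮ.starProjection (γ t - p)) (Lᗮ.starProjection l) 0 :=
    (Lᗮ.starProjection).hasFDerivAt.comp_hasDerivAt 0 (hγ.sub_const p)
  -- The exposing functional has a minimum along the curve at time 0. By the linear bound, the
  -- component orthogonal to L is then o(t) too.
  have hfl : f l = 0 := by
    refine IsLocalMin.hasDerivAt_eq_zero (f := fun t => f (γ t - p)) ?_ hf
    filter_upwards [hmem] with t ht
    simpa [h0] using (hfR _ ht).1
  have hfo : (fun t => f (γ t - p)) =o[𝓝 0] fun t : ℝ => t := by
    have := hf.isLittleO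
    simpa [hfl, h0] using this
  have hπo : (fun t => Lᗮ.starProjection (γ t - p)) =o[𝓝 0] fun t : ℝ => t := by
    refine Asymptotics.IsBigO.trans_isLittleO (Asymptotics.IsBigO.of_bound |R| ?_) hfo
    filter_upwards [hmem] with t ht
    refine (hfR _ ht).2.trans ?_
    rw [Real.norm_eq_abs, ← abs_mul]
    exact le_abs_self _
  have hπ0 : HasDerivAt (fun t => Lᗮ.starProjection (γ t - p)) 0 0 := by
    rw [hasDerivAt_iff_isLittleO]
    simpa [h0] using hπo
  have hl0 := hπ.unique hπ0
  rw [Submodule.starProjection_apply_eq_zero_iff, Submodule.orthogonal_orthogonal] at hl0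
  exact hl0

end Polytope

/-! ### The double of a convex body is Hausdorff, and is a sphere -/

section Double

variable {n : ℕ}

theorem Double.mk_eq_mk {P : Set (Euc n)} {a b : P × Bool} :
    (Quotient.mk (doubleSetoid P) a) = Quotient.mk (doubleSetoid P) b ↔
      a.1 = b.1 ∧ (a.2 = b.2 ∨ (a.1 : Euc n) ∈ frontier P) := Quotient.eq

theorem Double.compactSpace {P : Set (Euc n)} (hP : IsCompact P) : CompactSpace (Double P) := by
  have := isCompact_iff_compactSpace.1 hP
  infer_instance

/-- The sheet coordinate `± d(x, ∂P)` on `P × {0, 1}`. -/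
def signedDist (P : Set (Euc n)) (a : P × Bool) : ℝ :=
  (if a.2 then 1 else -1) * Metric.infDist (a.1 : Euc n) (frontier P)

theorem continuous_signedDist (P : Set (Euc n)) : Continuous (signedDist P) := by
  have h : Continuous fun b : Bool => if b then (1 : ℝ) else -1 := continuous_of_discreteTopology
  exact (h.comp continuous_snd).mul
    ((Metric.continuous_infDist_pt _).comp (continuous_subtype_val.comp continuous_fst))

instance Double.t2Space (P : Set (Euc n)) : T2Space (Double P) := by
  -- `Metric.infDist` to the empty set is 0, so the signed distance separates the sheets only when
  -- the frontier is nonempty. With empty frontier nothing is glued.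
  rcases (frontier P).eq_empty_or_nonempty with hem | hne
  · have hinj : Function.Injective
        (Quotient.lift id (fun a b h => Prod.ext h.1 (h.2.resolve_right (by simp [hem]))) :
          Double P → P × Bool) := by
      rintro ⟨a⟩ ⟨b⟩ h
      exact congrArg _ h
    exact T2Space.of_injective_continuous hinj (continuous_id.quotient_lift _)
  · have hwd : ∀ a b : P × Bool, (doubleSetoid P) a b →
        ((a.1, signedDist P a) : P × ℝ) = (b.1, signedDist P b) := by
      rintro ⟨x, s⟩ ⟨y, t⟩ ⟨h, h'⟩
      dsimp only at h h'
      subst h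
      rcases h' with rfl | h'
      · rfl
      · simp [signedDist, Metric.infDist_zero_of_mem h']
    have hcont : Continuous (Quotient.lift _ hwd : Double P → P × ℝ) :=
      (continuous_fst.prodMk (continuous_signedDist P)).quotient_lift hwd
    refine T2Space.of_injective_continuous (f := Quotient.lift _ hwd) ?_ hcont
    rintro ⟨x, s⟩ ⟨y, t⟩ h
    obtain ⟨h1, h2⟩ := Prod.ext_iff.1 h
    dsimp only at h1 h2
    subst h1
    refine Double.mk_eq_mk.2 ⟨rfl, ?_⟩
    by_contra! hc
    obtain ⟨hst, hx⟩ := hc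
    have hpos : 0 < Metric.infDist (x : Euc n) (frontier P) :=
      (isClosed_frontier.notMem_iff_infDist_pos hne).1 hx
    simp only [signedDist] at h2
    dsimp only at hst
    cases s <;> cases t <;> simp at hst h2 <;> linarith

/-- The point of the upper or lower hemisphere over a point of the closed unit ball. -/
def hemisphere (a : Euc n × Bool) : Euc (n + 1) :=
  WithLp.toLp 2 (Fin.snoc (fun i => a.1 i) ((if a.2 then 1 else -1) * √(1 - ‖a.1‖ ^ 2)))

theorem hemisphere_castSucc (a : Euc n × Bool) (i : Fin n) :
    hemisphere a i.castSucc = a.1 i := by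
  simp [hemisphere]

theorem hemisphere_last (a : Euc n × Bool) :
    hemisphere a (Fin.last n) = (if a.2 then 1 else -1) * √(1 - ‖a.1‖ ^ 2) := by
  simp [hemisphere]

theorem continuous_hemisphere : Continuous (hemisphere : Euc n × Bool → Euc (n + 1)) := by
  refine (PiLp.continuous_toLp 2 _).comp (continuous_pi fun i => ?_)
  refine Fin.lastCases ?_ (fun j => ?_) i
  · have h : Continuous fun b : Bool => if b then (1 : ℝ) else -1 := continuous_of_discreteTopology
    simp only [Fin.snoc_last]
    exact (h.comp continuous_snd).mul (by fun_prop)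
  · simp only [Fin.snoc_castSucc]
    fun_prop

theorem norm_hemisphere {a : Euc n × Bool} (ha : ‖a.1‖ ≤ 1) : ‖hemisphere a‖ = 1 := by
  have h0 : 0 ≤ 1 - ‖a.1‖ ^ 2 := by nlinarith [norm_nonneg a.1]
  rw [← sq_eq_sq₀ (norm_nonneg _) zero_le_one, EuclideanSpace.norm_sq_eq, Fin.sum_univ_castSucc,
    hemisphere_last]
  simp only [hemisphere_castSucc]
  rw [← EuclideanSpace.norm_sq_eq, norm_mul, mul_pow, Real.norm_eq_abs √_, sq_abs, Real.sq_sqrt h0]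
  split_ifs <;> simp

theorem hemisphere_eq_iff {a b : Euc n × Bool} (ha : ‖a.1‖ ≤ 1) :
    hemisphere a = hemisphere b ↔ a.1 = b.1 ∧ (a.2 = b.2 ∨ ‖a.1‖ = 1) := by
  have key : hemisphere a = hemisphere b ↔ a.1 = b.1 ∧
      hemisphere a (Fin.last n) = hemisphere b (Fin.last n) := by
    constructor
    · intro h
      refine ⟨?_, by rw [h]⟩
      ext i
      rw [← hemisphere_castSucc a, h, hemisphere_castSucc]
    · rintro ⟨h1, h2⟩
      ext i
      refine Fin.lastCases h2 (fun j => ?_) i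
      rw [hemisphere_castSucc, hemisphere_castSucc, h1]
  rw [key]
  refine and_congr_right fun h => ?_
  rw [hemisphere_last, hemisphere_last, ← h]
  constructor
  · intro h2
    by_contra! hc
    obtain ⟨hst, hx⟩ := hc
    have hlt : ‖a.1‖ < 1 := lt_of_le_of_ne ha hx
    have hpos : 0 < √(1 - ‖a.1‖ ^ 2) := Real.sqrt_pos.2 (by nlinarith [norm_nonneg a.1])
    obtain ⟨x, s⟩ := a
    obtain ⟨y, t⟩ := b
    dsimp only at *
    cases s <;> cases t <;> simp at hst h2 <;> linarith
  · rintro (h2 | h2)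
    · rw [h2]
    · simp [h2]

theorem exists_hemisphere_eq {z : Euc (n + 1)} (hz : ‖z‖ = 1) :
    ∃ a : Euc n × Bool, ‖a.1‖ ≤ 1 ∧ hemisphere a = z := by
  set x : Euc n := WithLp.toLp 2 fun i => z i.castSucc
  have hsum : ‖x‖ ^ 2 + z (Fin.last n) ^ 2 = 1 := by
    have h1 := EuclideanSpace.norm_sq_eq z
    rw [hz, Fin.sum_univ_castSucc] at h1
    rw [EuclideanSpace.norm_sq_eq]
    simpa [x] using h1.symm
  have hx : ‖x‖ ≤ 1 := by nlinarith [norm_nonneg x, sq_nonneg (z (Fin.last n))]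
  refine ⟨(x, decide (0 ≤ z (Fin.last n))), hx, ?_⟩
  ext i
  refine Fin.lastCases ?_ (fun j => ?_) i
  · rw [hemisphere_last]
    have : 1 - ‖x‖ ^ 2 = z (Fin.last n) ^ 2 := by linarith
    simp only [this, Real.sqrt_sq_eq_abs, decide_eq_true_eq]
    split_ifs with h
    · rw [one_mul, abs_of_nonneg h]
    · rw [abs_of_neg (not_le.1 h)]
      ring
  · rw [hemisphere_castSucc]

/-- The double of a convex body is a sphere. -/
theorem nonempty_double_homeomorph_sphere {P : Set (Euc n)} (hc : Convex ℝ P) (hP : IsCompact P)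
    (hne : (interior P).Nonempty) :
    Nonempty (Double P ≃ₜ Metric.sphere (0 : Euc (n + 1)) 1) := by
  obtain ⟨h, -, hcl, hfr⟩ :=
    exists_homeomorph_image_interior_closure_frontier_eq_unitBall hc hne hP.isBounded
  rw [hP.isClosed.closure_eq] at hcl
  have hball : ∀ x ∈ P, ‖h x‖ ≤ 1 := by
    intro x hx
    have : h x ∈ Metric.closedBall (0 : Euc n) 1 := hcl ▸ Set.mem_image_of_mem h hx
    simpa using this
  have hsph : ∀ x, ‖h x‖ = 1 ↔ x ∈ frontier P := by
    intro x
    rw [← mem_sphere_zero_iff_norm, ← hfr, h.injective.mem_set_image]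
  let f : P × Bool → Metric.sphere (0 : Euc (n + 1)) 1 := fun a =>
    ⟨hemisphere (h a.1, a.2), mem_sphere_zero_iff_norm.2 (norm_hemisphere (hball _ a.1.2))⟩
  have hf : Continuous f := by
    refine (continuous_hemisphere.comp ?_).subtype_mk _
    have := h.continuous
    fun_prop
  have hiff : ∀ a b : P × Bool, f a = f b ↔ (doubleSetoid P) a b := by
    intro a b
    have key := hemisphere_eq_iff (a := (h a.1, a.2)) (b := (h b.1, b.2)) (hball _ a.1.2)
    rw [h.injective.eq_iff, hsph, Subtype.coe_inj] at key
    exact Subtype.ext_iff.trans key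
  have hwd : ∀ a b : P × Bool, (doubleSetoid P) a b → f a = f b := fun a b => (hiff a b).2
  have := Double.compactSpace hP
  refine ⟨Continuous.homeoOfEquivCompactToT2
    (f := Equiv.ofBijective (Quotient.lift f hwd) ⟨?_, ?_⟩) (hf.quotient_lift hwd)⟩
  · rintro ⟨a⟩ ⟨b⟩ hab
    exact Quotient.sound ((hiff a b).1 hab)
  · rintro ⟨z, hz⟩
    obtain ⟨⟨x, s⟩, hx, rfl⟩ := exists_hemisphere_eq (mem_sphere_zero_iff_norm.1 hz)
    have hx' : x ∈ h '' P := by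
      rw [hcl]
      simpa using hx
    obtain ⟨y, hy, rfl⟩ := hx'
    exact ⟨Quotient.mk _ (⟨y, hy⟩, s), rfl⟩

end Double

/-! ### The standard action, its strata and its orbit map -/

section StandardAction

variable {n : ℕ}

theorem sign_eq_one_iff {a : ZMod 2} : sign a = 1 ↔ a = 0 := by
  unfold sign
  split_ifs with h
  · simp [h]
  · simp only [h, iff_false]
    norm_num

theorem sign_mul_eq_self_iff {a : ZMod 2} {r : ℝ} : sign a * r = r ↔ a = 0 ∨ r = 0 := by
  rw [← sub_eq_zero, ← sub_one_mul, mul_eq_zero, sub_eq_zero, sign_eq_one_iff]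

theorem stdAct_apply (t : TwoTorus n) (z : Euc n) (i : Fin n) :
    stdAct t z i = sign (t i) * z i := rfl

theorem stdAct_eq_self_iff {t : TwoTorus n} {z : Euc n} :
    stdAct t z = z ↔ ∀ i, t i = 0 ∨ z i = 0 := by
  rw [PiLp.ext_iff]
  exact forall_congr' fun i => sign_mul_eq_self_iff

theorem zmod_two_eq_one {a : ZMod 2} (h : a ≠ 0) : a = 1 := by
  revert a
  decide

theorem eq_zero_or_eq_single {t : TwoTorus n} {i : Fin n} (h : ∀ j ≠ i, t j = 0) :
    t = 0 ∨ t = Pi.single i 1 := by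
  by_cases hi : t i = 0
  · left
    ext j
    by_cases hj : j = i
    · rw [hj, hi, Pi.zero_apply]
    · rw [h j hj, Pi.zero_apply]
  · right
    ext j
    by_cases hj : j = i
    · rw [hj, zmod_two_eq_one hi, Pi.single_eq_same]
    · rw [h j hj, Pi.single_eq_of_ne hj]

/-- The vectors that vanish wherever `z` vanishes: the tangent space to the stratum of `z`. -/
def stratumSpace (z : Euc n) : Submodule ℝ (Euc n) where
  carrier := {v | ∀ i, z i = 0 → v i = 0}
  zero_mem' := fun _ _ => rfl
  add_mem' := fun ha hb i hi => by rw [PiLp.add_apply, ha i hi, hb i hi, add_zero]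
  smul_mem' := fun c v hv i hi => by rw [PiLp.smul_apply, hv i hi, smul_zero]

theorem mem_stratumSpace {z v : Euc n} : v ∈ stratumSpace z ↔ ∀ i, z i = 0 → v i = 0 := Iff.rfl

theorem stratumSpace_le_iff {z w : Euc n} :
    stratumSpace z ≤ stratumSpace w ↔ ∀ i, w i = 0 → z i = 0 := by
  constructor
  · intro h i hi
    exact h (mem_stratumSpace.2 fun _ hj => hj : z ∈ stratumSpace z) i hi
  · intro h v hv i hi
    exact hv i (h i hi)

theorem stratumSpace_eq_top_iff {z : Euc n} : stratumSpace z = ⊤ ↔ ∀ i, z i ≠ 0 := by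
  constructor
  · intro h i hi
    have : EuclideanSpace.single i (1 : ℝ) ∈ stratumSpace z := by rw [h]; trivial
    simpa using this i hi
  · intro h
    exact eq_top_iff.2 fun v _ i hi => absurd hi (h i)

theorem eq_zero_of_stratumSpace_eq_bot {z : Euc n} (h : stratumSpace z = ⊥) : z = 0 := by
  rw [← Submodule.mem_bot ℝ, ← h]
  exact fun _ hj => hj

theorem squares_apply (z : Euc n) (i : Fin n) : squares z i = z i ^ 2 := rfl

theorem squares_apply_eq_zero_iff {z : Euc n} {i : Fin n} : squares z i = 0 ↔ z i = 0 := by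
  rw [squares_apply, sq_eq_zero_iff]

/-- The map `squares` is open onto the orthant. -/
theorem image_squares_mem_nhdsWithin {U : Set (Euc n)} (hU : IsOpen U) {z : Euc n} (hz : z ∈ U) :
    squares '' U ∈ 𝓝[{w : Euc n | ∀ i, 0 ≤ w i}] squares z := by
  -- A continuous section of `squares` over the orthant, with signs chosen so that it passes through
  -- z.
  let r : Euc n → Euc n := fun w => WithLp.toLp 2 fun i => (if 0 ≤ z i then 1 else -1) * √(w i)
  have hr : Continuous r := by
    refine (PiLp.continuous_toLp 2 _).comp (continuous_pi fun i => ?_)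
    fun_prop
  have hrz : r (squares z) = z := by
    ext i
    change (if 0 ≤ z i then 1 else -1) * √(z i ^ 2) = z i
    rw [Real.sqrt_sq_eq_abs]
    split_ifs with h
    · rw [one_mul, abs_of_nonneg h]
    · rw [abs_of_neg (not_le.1 h)]
      ring
  have hmem : r ⁻¹' U ∈ 𝓝 (squares z) := hr.continuousAt (hU.mem_nhds (by rwa [hrz]))
  filter_upwards [mem_nhdsWithin_of_mem_nhds hmem, self_mem_nhdsWithin] with w hw hw0
  refine ⟨r w, hw, ?_⟩
  ext i
  change ((if 0 ≤ z i then 1 else -1) * √(w i)) ^ 2 = w i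
  rw [mul_pow, Real.sq_sqrt (hw0 i)]
  split_ifs <;> simp

/-- Vanishing coordinates stay 0 and positive ones stay positive for small t of either sign, so the
line remains in the orthant. Two-sided derivatives along it are therefore available at boundary
points. -/
theorem eventually_add_smul_mem_image_squares {U : Set (Euc n)} (hU : IsOpen U) {z v : Euc n}
    (hz : z ∈ U) (hv : v ∈ stratumSpace z) : ∀ᶠ t in 𝓝 (0 : ℝ), squares z + t • v ∈ squares '' U := by
  have hc : Continuous fun t : ℝ => squares z + t • v := by fun_prop
  have h0 : squares z + (0 : ℝ) • v = squares z := by simp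
  have horth : ∀ᶠ t in 𝓝 (0 : ℝ), squares z + t • v ∈ {w : Euc n | ∀ i, 0 ≤ w i} := by
    refine Filter.eventually_all.2 fun i => ?_
    by_cases hi : z i = 0
    · refine Filter.Eventually.of_forall fun t => ?_
      change 0 ≤ z i ^ 2 + t * v i
      simp [hi, hv i hi]
    · have hci : Continuous fun t : ℝ => (squares z + t • v) i := by
        change Continuous fun t : ℝ => z i ^ 2 + t * v i
        fun_prop
      have : ∀ᶠ t in 𝓝 (0 : ℝ), 0 < (squares z + t • v) i := by
        refine hci.continuousAt.eventually_const_lt ?_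
        change 0 < (squares z + (0 : ℝ) • v) i
        rw [h0, squares_apply]
        positivity
      exact this.mono fun t ht => ht.le
  have ht : Filter.Tendsto (fun t : ℝ => squares z + t • v) (𝓝 0)
      (𝓝[{w : Euc n | ∀ i, 0 ≤ w i}] squares z) := by
    refine tendsto_nhdsWithin_iff.2 ⟨?_, horth⟩
    exact hc.tendsto' 0 _ h0
  exact ht (image_squares_mem_nhdsWithin hU hz)

end StandardAction

/-! ### Quotients by finite groups are proper -/

section ProperQuotient

variable {Γ X : Type*} [AddGroup Γ] [Finite Γ] [TopologicalSpace X] [AddAction Γ X]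
  [ContinuousConstVAdd Γ X]

theorem isProperMap_quotient_orbitRel : IsProperMap (Quotient.mk (AddAction.orbitRel Γ X)) := by
  refine isProperMap_iff_isClosedMap_and_compact_fibers.2 ⟨continuous_quotient_mk', ?_, ?_⟩
  · intro C hC
    refine isQuotientMap_quotient_mk'.isClosed_preimage.1 ?_
    have : Quotient.mk (AddAction.orbitRel Γ X) ⁻¹' (Quotient.mk _ '' C) =
        ⋃ g : Γ, (g +ᵥ ·) ⁻¹' C := by
      ext x
      simp only [Set.mem_preimage, Set.mem_image, Set.mem_iUnion]
      constructor
      · rintro ⟨y, hy, h⟩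
        obtain ⟨g, rfl⟩ := Quotient.exact h
        exact ⟨g, hy⟩
      · rintro ⟨g, hg⟩
        exact ⟨_, hg, Quotient.sound ⟨g, rfl⟩⟩
    change IsClosed (Quotient.mk (AddAction.orbitRel Γ X) ⁻¹' (Quotient.mk _ '' C))
    rw [this]
    exact isClosed_iUnion_of_finite fun g => hC.preimage (continuous_const_vadd g)
  · intro y
    obtain ⟨x, rfl⟩ := Quotient.exists_rep y
    have : Quotient.mk (AddAction.orbitRel Γ X) ⁻¹' {Quotient.mk _ x} =
        Set.range fun g : Γ => g +ᵥ x := by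
      ext z
      simp only [Set.mem_preimage, Set.mem_singleton_iff]
      exact Quotient.eq
    rw [this]
    exact (Set.finite_range _).isCompact

end ProperQuotient

/-! ### Equivariant charts and reflection loci -/

section Charts

variable {n : ℕ} {X : Type*} [TopologicalSpace X] [AddAction (TwoTorus n) X]

/-- `φ` is equivariant with respect to the standard action, up to the automorphism `θ`. -/
def IsEquivariantChart (φ : OpenPartialHomeomorph X (Euc n))
    (θ : TwoTorus n ≃+ TwoTorus n) : Prop :=
  ∀ y ∈ φ.source, ∀ g : TwoTorus n, g +ᵥ y ∈ φ.source ∧ φ (g +ᵥ y) = stdAct (θ g) (φ y)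

variable {φ : OpenPartialHomeomorph X (Euc n)} {θ : TwoTorus n ≃+ TwoTorus n}

theorem IsEquivariantChart.vadd_eq_self_iff (hφ : IsEquivariantChart φ θ) {y : X}
    (hy : y ∈ φ.source) {g : TwoTorus n} : g +ᵥ y = y ↔ ∀ i, θ g i = 0 ∨ φ y i = 0 := by
  obtain ⟨h1, h2⟩ := hφ y hy g
  rw [← stdAct_eq_self_iff, ← h2]
  exact ⟨fun h => by rw [h], fun h => φ.injOn h1 hy h⟩

variable (X) in
/-- The closure of the set of all points with stabilizer `{0, g}`. In the cases of interest, this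
is the union of the components of codimension one of the fixed point set of `g`. -/
def reflectionLocus (g : TwoTorus n) : Set X :=
  closure {x : X | ∀ h : TwoTorus n, h +ᵥ x = x ↔ h = 0 ∨ h = g}

theorem IsEquivariantChart.mem_reflectionLocus_iff (hφ : IsEquivariantChart φ θ) {x : X}
    (hx : x ∈ φ.source) {g : TwoTorus n} (hg : g ≠ 0) :
    x ∈ reflectionLocus X g ↔ ∃ i, φ x i = 0 ∧ θ g = Pi.single i 1 := by
  constructor
  · intro h
    -- Coordinates that vanish at nearby points vanish at x already.
    have hnhds : ∀ᶠ y in 𝓝 x, y ∈ φ.source ∧ ∀ i, φ x i ≠ 0 → φ y i ≠ 0 := by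
      refine Filter.Eventually.and (φ.open_source.mem_nhds hx) (Filter.eventually_all.2 fun i => ?_)
      by_cases hi : φ x i = 0
      · simp [hi]
      · have : ContinuousAt (fun y => φ y i) x :=
          (EuclideanSpace.proj i : Euc n →L[ℝ] ℝ).continuous.continuousAt.comp
            (φ.continuousAt hx)
        exact (this.eventually_ne hi).mono fun y hy _ => hy
    obtain ⟨y, hy, hys, hyx⟩ := ((mem_closure_iff_frequently.1 h).and_eventually hnhds).exists
    have hθg : θ g ≠ 0 := by simpa using hg
    obtain ⟨i, hi⟩ := Function.ne_iff.1 hθg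
    have hgy := (hφ.vadd_eq_self_iff hys).1 ((hy g).2 (Or.inr rfl))
    have hyi : φ y i = 0 := (hgy i).resolve_left hi
    refine ⟨i, by_contra fun h0 => hyx i h0 hyi, ?_⟩
    have hstab : θ.symm (Pi.single i 1) +ᵥ y = y := by
      refine (hφ.vadd_eq_self_iff hys).2 fun j => ?_
      rw [AddEquiv.apply_symm_apply]
      by_cases hj : j = i
      · right; rw [hj, hyi]
      · left; rw [Pi.single_eq_of_ne hj]
    rcases (hy _).1 hstab with h0 | h0
    · have := congrFun ((AddEquiv.symm_apply_eq _).1 h0) i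
      simp at this
    · rw [← h0, AddEquiv.apply_symm_apply]
  · rintro ⟨i, hi, hθ⟩
    -- Moving along v makes every vanishing coordinate except the i-th nonzero, which leaves the
    -- stabilizer {0, g}.
    let v : Euc n := WithLp.toLp 2 fun j => if j = i ∨ φ x j ≠ 0 then 0 else 1
    have hc : Continuous fun t : ℝ => φ x + t • v := by fun_prop
    have h0 : φ x + (0 : ℝ) • v = φ x := by simp
    have hct : Filter.Tendsto (fun t : ℝ => φ x + t • v) (𝓝[≠] 0) (𝓝 (φ x)) :=
      (hc.tendsto' 0 _ h0).mono_left nhdsWithin_le_nhds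
    have hsymm : Filter.Tendsto (fun t : ℝ => φ.symm (φ x + t • v)) (𝓝[≠] 0) (𝓝 x) := by
      have := (φ.tendsto_symm hx).comp hct
      exact this
    refine mem_closure_of_tendsto hsymm ?_
    filter_upwards [hct (φ.open_target.mem_nhds (φ.map_source hx)), self_mem_nhdsWithin]
      with t ht ht0 h
    rw [hφ.vadd_eq_self_iff (φ.map_target ht), φ.right_inv ht]
    have hz : ∀ j, (φ x + t • v) j = 0 ↔ j = i := by
      intro j
      change φ x j + t * (if j = i ∨ φ x j ≠ 0 then 0 else 1) = 0 ↔ j = i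
      have ht0' : t ≠ 0 := ht0
      by_cases hj : j = i
      · simp [hj, hi]
      · by_cases hxj : φ x j = 0 <;> simp [hj, hxj, ht0']
    simp only [hz]
    constructor
    · intro hj
      rcases eq_zero_or_eq_single (t := θ h) fun j hji => (hj j).resolve_right hji with h1 | h1
      · left
        simpa using h1
      · right
        rw [← hθ] at h1
        exact θ.injective h1
    · rintro (rfl | rfl) j
      · left
        simp
      · rw [hθ]
        by_cases hj : j = i
        · exact Or.inr hj
        · exact Or.inl (Pi.single_eq_of_ne hj _)

end Charts

/-! ### Corner charts: strata of X and faces of P -/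

section CornerCharts

variable {n : ℕ} {X : Type*} [TopologicalSpace X] [AddAction (TwoTorus n) X]

/-- The projection of a small cover onto its polytope. -/
def proj {P : Set (Euc n)} (e : AddAction.orbitRel.Quotient (TwoTorus n) X ≃ₜ P) (x : X) : P :=
  e (Quotient.mk _ x)

theorem proj_eq_iff {P : Set (Euc n)} (e : AddAction.orbitRel.Quotient (TwoTorus n) X ≃ₜ P)
    {x y : X} : proj e x = proj e y ↔ ∃ g : TwoTorus n, g +ᵥ y = x :=
  e.injective.eq_iff.trans Quotient.eq

theorem isOpenQuotientMap_proj [ContinuousConstVAdd (TwoTorus n) X] {P : Set (Euc n)}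
    (e : AddAction.orbitRel.Quotient (TwoTorus n) X ≃ₜ P) : IsOpenQuotientMap (proj e) :=
  e.isOpenQuotientMap.comp AddAction.isOpenQuotientMap_quotientMk

theorem isProperMap_proj [ContinuousConstVAdd (TwoTorus n) X] {P : Set (Euc n)}
    (e : AddAction.orbitRel.Quotient (TwoTorus n) X ≃ₜ P) : IsProperMap (proj e) :=
  e.isProperMap.comp isProperMap_quotient_orbitRel

/-- The map `F` is `e` read in the corner chart induced by `φ`, and `H` is its inverse. -/
structure IsCornerChart {P : Set (Euc n)} (e : AddAction.orbitRel.Quotient (TwoTorus n) X ≃ₜ P)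
    (φ : OpenPartialHomeomorph X (Euc n)) (F H : Euc n → Euc n) : Prop where
  differentiableOn : DifferentiableOn ℝ F (squares '' φ.target)
  differentiableOn_inv : DifferentiableOn ℝ H ((fun y => (proj e y : Euc n)) '' φ.source)
  map_squares : ∀ y ∈ φ.source, F (squares (φ y)) = proj e y
  map_proj : ∀ y ∈ φ.source, H (proj e y) = squares (φ y)

namespace IsCornerChart

variable [ContinuousConstVAdd (TwoTorus n) X] {P : Set (Euc n)}
  {e : AddAction.orbitRel.Quotient (TwoTorus n) X ≃ₜ P}
  {φ : OpenPartialHomeomorph X (Euc n)} {F H : Euc n → Euc n}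

omit [ContinuousConstVAdd (TwoTorus n) X] in
theorem leftInvOn (h : IsCornerChart e φ F H) {w : Euc n} (hw : w ∈ squares '' φ.target) :
    F w ∈ (fun y => (proj e y : Euc n)) '' φ.source ∧ H (F w) = w := by
  obtain ⟨z, hz, rfl⟩ := hw
  have h1 := h.map_squares _ (φ.map_target hz)
  have h2 := h.map_proj _ (φ.map_target hz)
  rw [φ.right_inv hz] at h1 h2
  rw [h1]
  exact ⟨⟨_, φ.map_target hz, rfl⟩, h2⟩

theorem image_mem_nhdsWithin {y : X} (hy : y ∈ φ.source) :
    (fun y => (proj e y : Euc n)) '' φ.source ∈ 𝓝[P] (proj e y : Euc n) := by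
  have h1 : proj e '' φ.source ∈ 𝓝 (proj e y) :=
    (isOpenQuotientMap_proj e).isOpenMap.image_mem_nhds (φ.open_source.mem_nhds hy)
  have h2 := Filter.image_mem_map (m := ((↑) : P → Euc n)) h1
  rwa [map_nhds_subtype_val, Set.image_image] at h2

theorem eventually_mem_image {y : X} (hy : y ∈ φ.source) {l : Euc n} {ε : ℝ} (hε : 0 < ε)
    (hl : ∀ t : ℝ, |t| ≤ ε → (proj e y : Euc n) + t • l ∈ P) :
    ∀ᶠ t in 𝓝 (0 : ℝ), |t| < ε ∧
      (proj e y : Euc n) + t • l ∈ (fun y => (proj e y : Euc n)) '' φ.source := by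
  have hc : Continuous fun t : ℝ => (proj e y : Euc n) + t • l := by fun_prop
  have h1 : ∀ᶠ t in 𝓝 (0 : ℝ), |t| < ε := by
    filter_upwards [Metric.ball_mem_nhds (0 : ℝ) hε] with t ht
    simpa using ht
  have h2 : Filter.Tendsto (fun t : ℝ => (proj e y : Euc n) + t • l) (𝓝 0)
      (𝓝[P] (proj e y : Euc n)) :=
    tendsto_nhdsWithin_iff.2 ⟨hc.tendsto' 0 _ (by simp), h1.mono fun t ht => hl t ht.le⟩
  exact h1.and (h2 (image_mem_nhdsWithin hy))

/-- The differential of a corner chart identifies the tangent space of the stratum of `y` with the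
lineality space of the polytope at the image of `y`. -/
theorem finrank_lineality (h : IsCornerChart e φ F H) (hP : Convex ℝ P) {V : Finset (Euc n)}
    (hV : P = convexHull ℝ (V : Set (Euc n))) {y : X} (hy : y ∈ φ.source) :
    Module.finrank ℝ (lineality hP (proj e y).2) =
      Module.finrank ℝ (stratumSpace (φ y)) := by
  set s := squares '' φ.target
  set u := (fun y => (proj e y : Euc n)) '' φ.source
  have hws : squares (φ y) ∈ s := Set.mem_image_of_mem _ (φ.map_source hy)
  have hpu : (proj e y : Euc n) ∈ u := Set.mem_image_of_mem _ hy
  have hA := (h.differentiableOn _ hws).hasFDerivWithinAt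
  have hB := (h.differentiableOn_inv _ hpu).hasFDerivWithinAt
  set A := fderivWithin ℝ F s (squares (φ y))
  set B := fderivWithin ℝ H u (proj e y)
  have huP : u ⊆ P := by
    rintro - ⟨z, -, rfl⟩
    exact (proj e z).2
  have line : ∀ q l : Euc n, HasDerivAt (fun t : ℝ => q + t • l) l 0 := by
    intro q l
    simpa using ((hasDerivAt_id (0 : ℝ)).smul_const l).const_add q
  -- The within-derivatives A and B need not be mutually inverse a priori. They are so on the two
  -- subspaces, because F and H are inverse along lines that stay in their domains for both signs of
  -- t.
  have key1 : ∀ v ∈ stratumSpace (φ y), A v ∈ lineality hP (proj e y).2 ∧ B (A v) = v := by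
    intro v hv
    have hev := eventually_add_smul_mem_image_squares φ.open_target (φ.map_source hy) hv
    have hFc : HasDerivAt (F ∘ fun t : ℝ => squares (φ y) + t • v) (A v) 0 :=
      HasFDerivWithinAt.comp_hasDerivAt 0 (by simpa using hA) (line _ _) hev
    have h0 : (F ∘ fun t : ℝ => squares (φ y) + t • v) 0 = proj e y := by
      simp [h.map_squares y hy]
    have hFu : ∀ᶠ t in 𝓝 (0 : ℝ), (F ∘ fun t : ℝ => squares (φ y) + t • v) t ∈ u :=
      hev.mono fun t ht => (h.leftInvOn ht).1
    refine ⟨?_, ?_⟩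
    · subst hV
      exact mem_lineality_of_hasDerivAt V (proj e y).2 hFc h0 (hFu.mono fun t ht => huP ht)
    · have hHF := HasFDerivWithinAt.comp_hasDerivAt 0 (by rw [h0]; exact hB) hFc hFu
      refine hHF.unique ((line (squares (φ y)) v).congr_of_eventuallyEq ?_)
      exact hev.mono fun t ht => (h.leftInvOn ht).2
  have key2 : ∀ l ∈ lineality hP (proj e y).2, B l ∈ stratumSpace (φ y) ∧ A (B l) = l := by
    intro l hl
    obtain ⟨ε, hε, hl⟩ := exists_forall_mem_of_mem_lineality hP _ hl
    have hev : ∀ᶠ t in 𝓝 (0 : ℝ), (proj e y : Euc n) + t • l ∈ u :=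
      (eventually_mem_image hy hε hl).mono fun t ht => ht.2
    have hHc : HasDerivAt (H ∘ fun t : ℝ => (proj e y : Euc n) + t • l) (B l) 0 :=
      HasFDerivWithinAt.comp_hasDerivAt 0 (by simpa using hB) (line _ _) hev
    have h0 : (H ∘ fun t : ℝ => (proj e y : Euc n) + t • l) 0 = squares (φ y) := by
      simp [h.map_proj y hy]
    refine ⟨fun i hi => ?_, ?_⟩
    -- Along the line, the i-th coordinate of H is a square and equals 0 at t = 0, a minimum.
    · have hi' : HasDerivAt (fun t : ℝ => (H ((proj e y : Euc n) + t • l)) i) (B l i) 0 :=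
        (EuclideanSpace.proj i : Euc n →L[ℝ] ℝ).hasFDerivAt.comp_hasDerivAt 0 hHc
      refine IsLocalMin.hasDerivAt_eq_zero ?_ hi'
      filter_upwards [hev] with t ht
      obtain ⟨z, hz, hzt⟩ := ht
      have h2 : H ((proj e y : Euc n) + (0 : ℝ) • l) = squares (φ y) := h0
      dsimp only at hzt ⊢
      rw [h2, ← hzt, h.map_proj z hz, squares_apply_eq_zero_iff.2 hi, squares_apply]
      positivity
    · have hHs : ∀ᶠ t in 𝓝 (0 : ℝ), (H ∘ fun t : ℝ => (proj e y : Euc n) + t • l) t ∈ s := by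
        filter_upwards [hev] with t ht
        obtain ⟨z, hz, hzt⟩ := ht
        dsimp only at hzt
        rw [Function.comp_apply, ← hzt, h.map_proj z hz]
        exact Set.mem_image_of_mem _ (φ.map_source hz)
      have hFH := HasFDerivWithinAt.comp_hasDerivAt 0 (by rw [h0]; exact hA) hHc hHs
      refine hFH.unique ((line (proj e y : Euc n) l).congr_of_eventuallyEq ?_)
      filter_upwards [hev] with t ht
      obtain ⟨z, hz, hzt⟩ := ht
      dsimp only at hzt
      rw [Function.comp_apply, Function.comp_apply, ← hzt, h.map_proj z hz, h.map_squares z hz]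
  refine LinearEquiv.finrank_eq (LinearEquiv.ofLinearMap
    (B.toLinearMap.restrict fun l hl => (key2 l hl).1)
    (A.toLinearMap.restrict fun v hv => (key1 v hv).1) ?_ ?_)
  · ext1 v
    exact Subtype.ext (key1 v v.2).2
  · ext1 l
    exact Subtype.ext (key2 l l.2).2

theorem proj_mem_interior_iff (h : IsCornerChart e φ F H) (hP : IsPolytope P) {y : X}
    (hy : y ∈ φ.source) : (proj e y : Euc n) ∈ interior P ↔ ∀ i, φ y i ≠ 0 := by
  obtain ⟨⟨V, hV⟩, hne⟩ := hP
  have hc : Convex ℝ P := hV ▸ convex_convexHull ℝ _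
  rw [← lineality_eq_top_iff hc hne (proj e y).2, ← stratumSpace_eq_top_iff]
  have key := h.finrank_lineality hc hV hy
  constructor
  · intro h1
    refine Submodule.eq_top_of_finrank_eq ?_
    rw [← key, h1, finrank_top]
  · intro h1
    refine Submodule.eq_top_of_finrank_eq ?_
    rw [key, h1, finrank_top]

/-- Moving from the image of `y` in a direction of its lineality space does not change the
stratum. -/
theorem eventually_exists_stratum_eq (h : IsCornerChart e φ F H) (hP : IsPolytope P) {y : X}
    (hy : y ∈ φ.source) {l : Euc n} {ε : ℝ} (hε : 0 < ε)
    (hl : ∀ t : ℝ, |t| ≤ ε → (proj e y : Euc n) + t • l ∈ P) :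
    ∀ᶠ t in 𝓝 (0 : ℝ), ∃ z ∈ φ.source, (proj e z : Euc n) = (proj e y : Euc n) + t • l ∧
      ∀ i, φ z i = 0 ↔ φ y i = 0 := by
  obtain ⟨⟨V, hV⟩, hne⟩ := hP
  have hc : Convex ℝ P := hV ▸ convex_convexHull ℝ _
  have hev := eventually_mem_image hy hε hl
  have hHt : Filter.Tendsto (fun t : ℝ => H ((proj e y : Euc n) + t • l)) (𝓝 0)
      (𝓝 (squares (φ y))) := by
    have h1 : ContinuousWithinAt H ((fun y => (proj e y : Euc n)) '' φ.source) (proj e y) :=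
      (h.differentiableOn_inv _ (Set.mem_image_of_mem _ hy)).continuousWithinAt
    rw [← h.map_proj y hy]
    refine h1.tendsto.comp (tendsto_nhdsWithin_iff.2 ⟨?_, hev.mono fun t ht => ht.2⟩)
    exact Continuous.tendsto' (by fun_prop) 0 _ (by simp)
  have hne0 : ∀ᶠ t in 𝓝 (0 : ℝ), ∀ i, φ y i ≠ 0 → H ((proj e y : Euc n) + t • l) i ≠ 0 := by
    refine Filter.eventually_all.2 fun i => ?_
    by_cases hi : φ y i = 0
    · simp [hi]
    · have := ((EuclideanSpace.proj i : Euc n →L[ℝ] ℝ).continuous.tendsto _).comp hHt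
      exact (this.eventually_ne (mt squares_apply_eq_zero_iff.1 hi)).mono fun t ht _ => ht
  filter_upwards [hev, hne0] with t ⟨htε, z, hz, hzt⟩ ht
  dsimp only at hzt
  refine ⟨z, hz, hzt, ?_⟩
  rw [← hzt, h.map_proj z hz] at ht
  have hle : ∀ i, φ z i = 0 → φ y i = 0 := fun i hi => by
    by_contra h0
    exact ht i h0 (squares_apply_eq_zero_iff.2 hi)
  have hlin : lineality hc (proj e z).2 = lineality hc (proj e y).2 := by
    have := lineality_add_smul hc (proj e y).2 hl htε (hzt ▸ (proj e z).2)
    simpa only [← hzt] using this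
  have hfin := h.finrank_lineality hc hV hz
  rw [hlin, h.finrank_lineality hc hV hy] at hfin
  -- Continuity only shows that no further coordinate becomes 0; equality of dimensions excludes
  -- that a vanishing one becomes nonzero.
  have heq := Submodule.eq_of_le_of_finrank_eq (stratumSpace_le_iff.2 hle) hfin
  exact fun i => ⟨hle i, stratumSpace_le_iff.1 heq.ge i⟩

end IsCornerChart

/-- `e` has equivariant corner charts around all points. -/
def HasCornerCharts {P : Set (Euc n)}
    (e : AddAction.orbitRel.Quotient (TwoTorus n) X ≃ₜ P) : Prop :=
  ∀ x : X, ∃ (φ : OpenPartialHomeomorph X (Euc n)) (θ : TwoTorus n ≃+ TwoTorus n)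
    (F H : Euc n → Euc n), x ∈ φ.source ∧ IsEquivariantChart φ θ ∧ IsCornerChart e φ F H

namespace HasCornerCharts

variable [ContinuousConstVAdd (TwoTorus n) X] {P : Set (Euc n)}
  {e : AddAction.orbitRel.Quotient (TwoTorus n) X ≃ₜ P}

/-- Points over the interior of the polytope have trivial stabilizer. -/
theorem eq_zero_of_vadd_eq_self (h : HasCornerCharts e) (hP : IsPolytope P) {x : X}
    (hx : (proj e x : Euc n) ∈ interior P) {g : TwoTorus n} (hg : g +ᵥ x = x) : g = 0 := by
  obtain ⟨φ, θ, F, H, hxs, hφ, hc⟩ := h x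
  have h0 := (hc.proj_mem_interior_iff hP hxs).1 hx
  have h1 := (hφ.vadd_eq_self_iff hxs).1 hg
  have : θ g = 0 := funext fun i => (h1 i).resolve_right (h0 i)
  simpa using this

/-- A point over the boundary of the polytope lies in a reflection locus. -/
theorem exists_mem_reflectionLocus (h : HasCornerCharts e) (hP : IsPolytope P) {x : X}
    (hx : (proj e x : Euc n) ∉ interior P) :
    ∃ g : TwoTorus n, g ≠ 0 ∧ g +ᵥ x = x ∧ x ∈ reflectionLocus X g := by
  obtain ⟨φ, θ, F, H, hxs, hφ, hc⟩ := h x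
  rw [hc.proj_mem_interior_iff hP hxs] at hx
  push Not at hx
  obtain ⟨i, hi⟩ := hx
  have hg : θ.symm (Pi.single i 1) ≠ 0 := by simp
  refine ⟨θ.symm (Pi.single i 1), hg, ?_, ?_⟩
  · refine (hφ.vadd_eq_self_iff hxs).2 fun j => ?_
    rw [AddEquiv.apply_symm_apply]
    by_cases hj : j = i
    · right; rw [hj, hi]
    · left; rw [Pi.single_eq_of_ne hj]
  · exact (hφ.mem_reflectionLocus_iff hxs hg).2 ⟨i, hi, by simp⟩

/-- The image of a reflection locus contains a vertex: a point of maximal norm is one. -/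
theorem exists_forall_vadd_eq_self (h : HasCornerCharts e) (hP : IsPolytope P) {g : TwoTorus n}
    (hg : g ≠ 0) (hne : (reflectionLocus X g).Nonempty) :
    ∃ x ∈ reflectionLocus X g, ∀ t : TwoTorus n, t +ᵥ x = x := by
  have hPc : IsCompact P := by
    obtain ⟨⟨V, rfl⟩, -⟩ := hP
    exact V.finite_toSet.isCompact_convexHull (𝕜 := ℝ)
  have : CompactSpace P := isCompact_iff_compactSpace.1 hPc
  have hXc : IsCompact (Set.univ : Set X) :=
    (isProperMap_proj e).isCompact_preimage (isCompact_univ (X := P))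
  have hcont : Continuous fun x : X => ‖(proj e x : Euc n)‖ :=
    (continuous_subtype_val.comp (isProperMap_proj e).continuous).norm
  have hRc : IsCompact (reflectionLocus X g) := hXc.of_isClosed_subset isClosed_closure
    (Set.subset_univ _)
  obtain ⟨x, hx, hmax⟩ := hRc.exists_isMaxOn hne hcont.continuousOn
  refine ⟨x, hx, ?_⟩
  obtain ⟨φ, θ, F, H, hxs, hφ, hc⟩ := h x
  have hconv : Convex ℝ P := by
    obtain ⟨⟨V, rfl⟩, -⟩ := hP
    exact convex_convexHull ℝ _
  -- Small moves both ways along l stay in the image of the locus, where the norm is maximal at x.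
  -- The parallelogram law then forces l = 0.
  have hbot : lineality hconv (proj e x).2 = ⊥ := by
    refine (Submodule.eq_bot_iff _).2 fun l hl => ?_
    obtain ⟨ε, hε, hl⟩ := exists_forall_mem_of_mem_lineality hconv _ hl
    have hle : ∀ᶠ t in 𝓝 (0 : ℝ), ‖(proj e x : Euc n) + t • l‖ ≤ ‖(proj e x : Euc n)‖ := by
      filter_upwards [hc.eventually_exists_stratum_eq hP hxs hε hl] with t ⟨z, hz, hzt, hzi⟩
      rw [← hzt]
      refine hmax ?_
      obtain ⟨i, hi, hθ⟩ := (hφ.mem_reflectionLocus_iff hxs hg).1 hx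
      exact (hφ.mem_reflectionLocus_iff hz hg).2 ⟨i, (hzi i).2 hi, hθ⟩
    obtain ⟨δ, hδ, hball⟩ := Metric.eventually_nhds_iff.1 hle
    have h1 := hball (y := δ / 2) (by rw [Real.dist_eq, sub_zero, abs_of_pos] <;> linarith)
    have h2 := hball (y := -(δ / 2)) (by
      rw [Real.dist_eq, sub_zero, abs_neg, abs_of_pos] <;> linarith)
    have h3 := parallelogram_law_with_norm ℝ (proj e x : Euc n) ((δ / 2) • l)
    rw [neg_smul, ← sub_eq_add_neg] at h2
    have h4 : ‖(δ / 2) • l‖ = 0 := by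
      nlinarith [norm_nonneg ((proj e x : Euc n) + (δ / 2) • l), norm_nonneg ((δ / 2) • l),
        norm_nonneg ((proj e x : Euc n) - (δ / 2) • l)]
    exact (smul_eq_zero.1 (norm_eq_zero.1 h4)).resolve_left (by positivity)
  have hz : φ x = 0 := by
    obtain ⟨⟨V, hV⟩, -⟩ := hP
    refine eq_zero_of_stratumSpace_eq_bot (Submodule.finrank_eq_zero.1 ?_)
    rw [← hc.finrank_lineality hconv hV hxs, hbot, finrank_bot]
  intro t
  exact (hφ.vadd_eq_self_iff hxs).2 fun i => Or.inr (by simp [hz])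

end HasCornerCharts

end CornerCharts

/-! ### Weights of the tangent representation from equivariant charts -/

section Weights

variable {n : ℕ} {X : Type*} [TopologicalSpace X] [ChartedSpace (Euc n) X]
  [AddAction (TwoTorus n) X]

/-- The standard action as a continuous linear map. -/
def stdActL (t : TwoTorus n) : Euc n →L[ℝ] Euc n :=
  LinearMap.toContinuousLinearMap
    { toFun := stdAct t
      map_add' := fun z w => by
        ext i
        exact mul_add _ _ _
      map_smul' := fun c z => by
        ext i
        exact mul_left_comm _ _ _ }

theorem coe_stdActL (t : TwoTorus n) : ⇑(stdActL t) = stdAct t := rfl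

theorem stdAct_single (t : TwoTorus n) (i : Fin n) :
    stdAct t (EuclideanSpace.single i (1 : ℝ)) = sign (t i) • EuclideanSpace.single i (1 : ℝ) := by
  ext j
  rw [stdAct_apply, PiLp.smul_apply, smul_eq_mul]
  by_cases hj : j = i
  · rw [hj]
  · simp [hj]

omit [AddAction (TwoTorus n) X] in
theorem mdifferentiable_of_mem_maximalAtlas {φ : OpenPartialHomeomorph X (Euc n)}
    (h : φ ∈ IsManifold.maximalAtlas (𝓡 n) ∞ X) : φ.MDifferentiable (𝓡 n) (𝓡 n) :=
  ⟨(contMDiffOn_of_mem_maximalAtlas h).mdifferentiableOn (by simp),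
    (contMDiffOn_symm_of_mem_maximalAtlas h).mdifferentiableOn (by simp)⟩

/-- The coordinates in an equivariant chart yield the weights at a fixed point. -/
theorem isWeights_of_isEquivariantChart {φ : OpenPartialHomeomorph X (Euc n)}
    {θ : TwoTorus n ≃+ TwoTorus n} (hφ : φ ∈ IsManifold.maximalAtlas (𝓡 n) ∞ X)
    (hθ : IsEquivariantChart φ θ)
    (hsm : ∀ g : TwoTorus n, ContMDiff (𝓡 n) (𝓡 n) ∞ (fun x : X => g +ᵥ x))
    {x : X} (hxs : x ∈ φ.source) (G : AddSubgroup (TwoTorus n)) (hx : ∀ g : G, g +ᵥ x = x) :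
    IsWeights G x fun i => ((Pi.evalAddMonoidHom (fun _ => ZMod 2) i).comp θ.toAddMonoidHom).comp
      G.subtype := by
  have hd := mdifferentiable_of_mem_maximalAtlas hφ
  let Φ : Euc n ≃L[ℝ] Euc n := hd.mfderiv hxs
  -- The standard basis pulled back by the differential of φ. Differentiating the equivariance of φ
  -- at x shows that it diagonalizes the action.
  let B : Module.Basis (Fin n) ℝ (Euc n) :=
    (EuclideanSpace.basisFun (Fin n) ℝ).toBasis.map Φ.symm.toLinearEquiv
  have hb : ∀ i, B i = Φ.symm (EuclideanSpace.single i (1 : ℝ)) := fun i => by simp [B]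
  suffices hB : ∀ (g : G) (i : Fin n),
      (mfderiv (𝓡 n) (𝓡 n) (fun y : X => g +ᵥ y) x : Euc n →L[ℝ] Euc n) (B i) =
        sign (θ (g : TwoTorus n) i) • B i from ⟨B, hB⟩
  intro g i
  rw [hb]
  set b : Euc n := Φ.symm (EuclideanSpace.single i (1 : ℝ))
  have hΦb : Φ b = EuclideanSpace.single i (1 : ℝ) := Φ.apply_symm_apply _
  have hgx : (fun y : X => g +ᵥ y) x = x := hx g
  have hgd : MDifferentiableAt (𝓡 n) (𝓡 n) (fun y : X => g +ᵥ y) x :=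
    (hsm (g : TwoTorus n)).mdifferentiable (by simp) x
  have hφd : MDifferentiableAt (𝓡 n) (𝓡 n) φ x := hd.mdifferentiableAt hxs
  have h1 := mfderiv_comp x (g := φ) (f := fun y : X => g +ᵥ y) (I := 𝓡 n) (I' := 𝓡 n)
    (I'' := 𝓡 n) (by rw [hx g]; exact hφd) hgd
  have h2 := mfderiv_comp x (g := stdAct (θ (g : TwoTorus n))) (f := φ) (I := 𝓡 n) (I' := 𝓡 n)
    (I'' := 𝓡 n) ((stdActL (θ (g : TwoTorus n))).mdifferentiableAt) hφd
  have h3 : (φ ∘ fun y : X => g +ᵥ y) =ᶠ[𝓝 x] stdAct (θ (g : TwoTorus n)) ∘ φ := by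
    filter_upwards [φ.open_source.mem_nhds hxs] with y hy
    exact (hθ y hy g).2
  have h4 := h3.mfderiv_eq (I := 𝓡 n) (I' := 𝓡 n)
  -- The chain rule yields the differential of φ at g + x. All tangent spaces are `Euc n` by
  -- definition, so it can be compared with the one at x.
  have h5 : ∀ y : X, y = x → (mfderiv (𝓡 n) (𝓡 n) φ y : Euc n →L[ℝ] Euc n) =
      (mfderiv (𝓡 n) (𝓡 n) φ x : Euc n →L[ℝ] Euc n) := by
    rintro y rfl
    rfl
  have h6 : ∀ z, (mfderiv (𝓡 n) (𝓡 n) (stdAct (θ (g : TwoTorus n))) z : Euc n →L[ℝ] Euc n) =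
      stdActL (θ (g : TwoTorus n)) := fun z =>
    (stdActL (θ (g : TwoTorus n))).mfderiv_eq
  apply Φ.injective
  have h7 : (mfderiv (𝓡 n) (𝓡 n) φ ((fun y : X => g +ᵥ y) x) : Euc n →L[ℝ] Euc n)
      ((mfderiv (𝓡 n) (𝓡 n) (fun y : X => g +ᵥ y) x : Euc n →L[ℝ] Euc n) b) =
      (mfderiv (𝓡 n) (𝓡 n) (stdAct (θ (g : TwoTorus n))) (φ x) : Euc n →L[ℝ] Euc n)
        ((mfderiv (𝓡 n) (𝓡 n) φ x : Euc n →L[ℝ] Euc n) b) :=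
    DFunLike.congr_fun (h1.symm.trans (h4.trans h2)) b
  rw [h5 _ hgx, h6] at h7
  have h8 : Φ ((mfderiv (𝓡 n) (𝓡 n) (fun y : X => g +ᵥ y) x : Euc n →L[ℝ] Euc n) b) =
      stdActL (θ (g : TwoTorus n)) (Φ b) := h7
  rw [hΦb, coe_stdActL, stdAct_single] at h8
  rw [h8, map_smul, hΦb]

end Weights

/-! ### Index-two subgroups and independence of weights -/

section GeneralPosition

variable {n : ℕ}

/-- A homomorphism with kernel a subgroup of index two. -/
def indexTwoHom {Γ : Type*} [AddGroup Γ] {G : AddSubgroup Γ} (h : G.index = 2) :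
    Γ →+ ZMod 2 := by
  classical exact
  { toFun := fun t => if t ∈ G then 0 else 1
    map_zero' := if_pos G.zero_mem
    map_add' := fun a b => by
      rw [AddSubgroup.add_mem_iff_of_index_two h]
      by_cases ha : a ∈ G <;> by_cases hb : b ∈ G <;> simp [ha, hb]
      decide }

theorem indexTwoHom_eq_zero_iff {Γ : Type*} [AddGroup Γ] {G : AddSubgroup Γ} (h : G.index = 2)
    {t : Γ} : indexTwoHom h t = 0 ↔ t ∈ G := by
  classical
  change (if t ∈ G then (0 : ZMod 2) else 1) = 0 ↔ t ∈ G
  split_ifs with ht <;> simp [ht]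

/-- If any `n - 1` of the coordinates are independent on a subgroup of index two, then that subgroup
contains no coordinate vector. -/
theorem single_notMem_of_linearIndependent {G : AddSubgroup (TwoTorus n)} (h : G.index = 2)
    (θ : TwoTorus n ≃+ TwoTorus n) (i : Fin n)
    (hli : LinearIndependent (ZMod 2) fun j : {j : Fin n // j ≠ i} =>
      ((Pi.evalAddMonoidHom (fun _ => ZMod 2) (j : Fin n)).comp θ.toAddMonoidHom).comp G.subtype) :
    θ.symm (Pi.single i 1) ∉ G := by
  intro hi
  set χ := (indexTwoHom h).comp θ.symm.toAddMonoidHom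
  have hχ : ∀ t, χ t = ∑ j, t j * χ (Pi.single j 1) := by
    intro t
    have : χ t = (χ.toZModLinearMap 2) t := rfl
    rw [this, LinearMap.pi_apply_eq_sum_univ]
    refine Finset.sum_congr rfl fun j _ => ?_
    refine congrArg (fun v => t j * χ v) (funext fun k => ?_)
    simp only [Pi.single_apply, eq_comm]
  have hi0 : χ (Pi.single i 1) = 0 := (indexTwoHom_eq_zero_iff h).2 hi
  have hall : ∀ j, χ (Pi.single j 1) = 0 := by
    intro j
    by_cases hj : j = i
    · rw [hj, hi0]
    -- On G the functional χ ∘ θ vanishes. Its i-th coefficient is 0, so this is a relation among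
    -- the remaining coordinates.
    have := Fintype.linearIndependent_iff.1 hli (fun j => χ (Pi.single (j : Fin n) 1)) ?_ ⟨j, hj⟩
    · exact this
    ext g
    have hg : χ (θ g) = 0 := by
      change indexTwoHom h (θ.symm (θ g)) = 0
      rw [AddEquiv.symm_apply_apply, indexTwoHom_eq_zero_iff]
      exact g.2
    rw [hχ, ← Finset.add_sum_erase _ _ (Finset.mem_univ i), hi0, mul_zero, zero_add] at hg
    rw [AddMonoidHom.finsetSum_apply, AddMonoidHom.zero_apply, ← hg]
    rw [Finset.sum_subtype (p := fun j => j ≠ i) (Finset.univ.erase i) (by simp)]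
    exact Finset.sum_congr rfl fun j _ => mul_comm _ _
  have htop : G = ⊤ := by
    refine eq_top_iff.2 fun t _ => (indexTwoHom_eq_zero_iff h).1 ?_
    have h1 := hχ (θ t)
    simp only [hall, mul_zero, Finset.sum_const_zero] at h1
    rw [← h1]
    change _ = indexTwoHom h (θ.symm (θ t))
    rw [AddEquiv.symm_apply_apply]
  rw [htop, AddSubgroup.index_top] at h
  omega

end GeneralPosition

/-! ### Stabilizers over the boundary are not contained in G -/

namespace IsSmallCover

variable {n : ℕ} {X : Type*} [TopologicalSpace X] [ChartedSpace (Euc n) X]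
  [AddAction (TwoTorus n) X] {P : Set (Euc n)}
  {e : AddAction.orbitRel.Quotient (TwoTorus n) X ≃ₜ P}

theorem continuousConstVAdd (h : IsSmallCover P e) : ContinuousConstVAdd (TwoTorus n) X :=
  ⟨fun g => (h.smooth g).continuous⟩

theorem exists_cornerChart (h : IsSmallCover P e) (x : X) :
    ∃ (φ : OpenPartialHomeomorph X (Euc n)) (θ : TwoTorus n ≃+ TwoTorus n) (F H : Euc n → Euc n),
      φ ∈ IsManifold.maximalAtlas (𝓡 n) ∞ X ∧ x ∈ φ.source ∧ IsEquivariantChart φ θ ∧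
      IsCornerChart e φ F H := by
  obtain ⟨φ, ⟨hφ, θ, hθ⟩, hx, F, H, hF, hH, hFH⟩ := h.diffeo x
  exact ⟨φ, θ, F, H, hφ, hx, hθ, hF.differentiableOn (by simp), hH.differentiableOn (by simp),
    fun y hy => (hFH y hy).1.symm, fun y hy => (hFH y hy).2⟩

theorem hasCornerCharts (h : IsSmallCover P e) : HasCornerCharts e := fun x =>
  let ⟨φ, θ, F, H, _, h'⟩ := h.exists_cornerChart x
  ⟨φ, θ, F, H, h'⟩

/-- Over the boundary of the polytope, no stabilizer is contained in a subtorus in general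
position. -/
theorem exists_notMem_vadd_eq_self (h : IsSmallCover P e)
    {G : AddSubgroup (TwoTorus n)} (hG : IsSubtorusInGeneralPosition X G) {x : X}
    (hx : (proj e x : Euc n) ∉ interior P) : ∃ g : TwoTorus n, g ∉ G ∧ g +ᵥ x = x := by
  have := h.continuousConstVAdd
  obtain ⟨g, hg0, hgx, hxR⟩ := h.hasCornerCharts.exists_mem_reflectionLocus h.simple.1 hx
  refine ⟨g, fun hgG => ?_, hgx⟩
  -- General position is a condition at fixed points only, so the same g is carried along its locus
  -- to a fixed point v.
  obtain ⟨v, hvR, hv⟩ := h.hasCornerCharts.exists_forall_vadd_eq_self h.simple.1 hg0 ⟨x, hxR⟩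
  obtain ⟨φ, θ, F, H, hφ, hvs, hθ, -⟩ := h.exists_cornerChart v
  obtain ⟨i, -, hi⟩ := (hθ.mem_reflectionLocus_iff hvs hg0).1 hvR
  have hw := isWeights_of_isEquivariantChart hφ hθ h.smooth hvs G fun g => hv g
  refine single_notMem_of_linearIndependent hG.1 θ i (hG.2 v (fun g => hv g) _ hw i) ?_
  rwa [← hi, AddEquiv.symm_apply_apply]

end IsSmallCover

/-! ### The map from X to the double -/

section OrbitSpace

variable {n : ℕ} {X : Type*} [TopologicalSpace X] [T2Space X] [AddAction (TwoTorus n) X]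
  [ContinuousConstVAdd (TwoTorus n) X] {P : Set (Euc n)}
  {e : AddAction.orbitRel.Quotient (TwoTorus n) X ≃ₜ P}

/-- If the action is free over the interior of `P`, then the projection has a section there. -/
theorem exists_section [LocallyCompactSpace X] (hc : Convex ℝ P) (hne : (interior P).Nonempty)
    (hfree : ∀ x : X, (proj e x : Euc n) ∈ interior P → ∀ g : TwoTorus n, g +ᵥ x = x → g = 0) :
    ∃ σ : Euc n → X, ContinuousOn σ (interior P) ∧
      ∀ p ∈ interior P, (proj e (σ p) : Euc n) = p := by
  have hcov := (isOpenQuotientMap_proj e).isQuotientMap.isCoveringMapOn_of_properlyDiscontinuousVAdd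
    (G := TwoTorus n) (proj_eq_iff e)
  have := hc.interior.contractibleSpace hne
  have := SimplyConnectedSpace.ofContractible (interior P)
  have : LocallyPathConnectedSpace (interior P) := isOpen_interior.locallyPathConnectedSpace
  let f : C(interior P, P) :=
    ⟨Set.inclusion interior_subset, continuous_inclusion interior_subset⟩
  obtain ⟨p₀, hp₀⟩ := hne
  obtain ⟨x₀, hx₀⟩ := (isOpenQuotientMap_proj e).surjective (f ⟨p₀, hp₀⟩)
  obtain ⟨σ, ⟨-, hσ⟩, -⟩ := hcov.existsUnique_continuousMap_lifts f hx₀ (fun p => by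
    obtain ⟨x, hx⟩ := (isOpenQuotientMap_proj e).surjective (f p)
    refine ⟨x, (AddSubgroup.eq_bot_iff_forall _).2 fun g hg => hfree x ?_ g hg, hx⟩
    rw [hx]
    exact p.2)
  classical
  -- The value off the interior is immaterial: over the boundary the two sheets are identified.
  refine ⟨fun p => if hp : p ∈ interior P then σ ⟨p, hp⟩ else x₀, ?_, fun p hp => ?_⟩
  · rw [continuousOn_iff_continuous_domRestrict]
    convert σ.continuous using 1
    ext p
    exact dif_pos p.2
  · simp only [dif_pos hp]
    have := congrFun hσ ⟨p, hp⟩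
    exact congrArg Subtype.val this

open Classical in
/-- The sheet of the double to which a point of `X` is mapped. -/
def sheet (e : AddAction.orbitRel.Quotient (TwoTorus n) X ≃ₜ P) (σ : Euc n → X)
    (G : AddSubgroup (TwoTorus n)) (x : X) : Bool :=
  decide (∃ g ∈ G, x = g +ᵥ σ (proj e x))

/-- The map from `X` to the double of `P`, for a section `σ` over the interior of `P`. -/
def toDouble (e : AddAction.orbitRel.Quotient (TwoTorus n) X ≃ₜ P) (σ : Euc n → X)
    (G : AddSubgroup (TwoTorus n)) (x : X) : Double P :=
  Quotient.mk _ (proj e x, sheet e σ G x)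

omit [T2Space X] [ContinuousConstVAdd (TwoTorus n) X] in
theorem proj_vadd (g : TwoTorus n) (x : X) : proj e (g +ᵥ x) = proj e x :=
  (proj_eq_iff e).2 ⟨g, rfl⟩

section

variable {σ : Euc n → X} {G : AddSubgroup (TwoTorus n)}

omit [T2Space X] [ContinuousConstVAdd (TwoTorus n) X] in
theorem exists_eq_vadd_section (hσ : ∀ p ∈ interior P, (proj e (σ p) : Euc n) = p) {x : X}
    (hx : (proj e x : Euc n) ∈ interior P) : ∃ g : TwoTorus n, x = g +ᵥ σ (proj e x) := by
  obtain ⟨g, hg⟩ := (proj_eq_iff e).1 (Subtype.ext (hσ _ hx).symm : proj e x = proj e (σ _))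
  exact ⟨g, hg.symm⟩

omit [TopologicalSpace X] [T2Space X] [ContinuousConstVAdd (TwoTorus n) X] in
theorem eq_of_vadd_eq_vadd {y : X} (hy : ∀ g : TwoTorus n, g +ᵥ y = y → g = 0)
    {g h : TwoTorus n} (hgh : g +ᵥ y = h +ᵥ y) : g = h := by
  refine sub_eq_zero.1 (hy _ ?_)
  rw [sub_eq_neg_add, add_vadd, hgh, neg_vadd_vadd]

variable (hσ : ∀ p ∈ interior P, (proj e (σ p) : Euc n) = p)
  (hfree : ∀ x : X, (proj e x : Euc n) ∈ interior P → ∀ g : TwoTorus n, g +ᵥ x = x → g = 0)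

include hσ hfree

omit [T2Space X] [ContinuousConstVAdd (TwoTorus n) X] in
theorem sheet_eq_true_iff {x : X} (hx : (proj e x : Euc n) ∈ interior P) {h : TwoTorus n}
    (hxh : x = h +ᵥ σ (proj e x)) : sheet e σ G x = true ↔ h ∈ G := by
  classical
  rw [sheet, decide_eq_true_iff]
  constructor
  · rintro ⟨g, hg, hxg⟩
    rwa [eq_of_vadd_eq_vadd (hfree (σ (proj e x)) (by rwa [hσ _ hx])) (hxh.symm.trans hxg)]
  · exact fun hh => ⟨h, hh, hxh⟩

/-- Each of the finitely many conditions y = g + σ(p), with p the image of y, is closed over the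
interior. Those that fail at x fail nearby, so the translating element is locally constant. -/
theorem eventually_sheet_eq (hσc : ContinuousOn σ (interior P)) {x : X}
    (hx : (proj e x : Euc n) ∈ interior P) : ∀ᶠ y in 𝓝 x, sheet e σ G y = sheet e σ G x := by
  have hproj : Continuous fun y : X => (proj e y : Euc n) :=
    continuous_subtype_val.comp (isOpenQuotientMap_proj e).continuous
  have hcσ : ContinuousAt (fun y : X => σ (proj e y)) x :=
    ContinuousAt.comp (f := fun y : X => (proj e y : Euc n))
      (hσc.continuousAt (isOpen_interior.mem_nhds hx)) hproj.continuousAt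
  have hint : ∀ᶠ y in 𝓝 x, (proj e y : Euc n) ∈ interior P :=
    hproj.continuousAt (isOpen_interior.mem_nhds hx)
  have hsep : ∀ᶠ y in 𝓝 x, ∀ g : TwoTorus n, y = g +ᵥ σ (proj e y) → x = g +ᵥ σ (proj e x) := by
    refine Filter.eventually_all.2 fun g => ?_
    by_cases hg : x = g +ᵥ σ (proj e x)
    · exact Filter.Eventually.of_forall fun _ _ => hg
    · have : ContinuousAt (fun y : X => g +ᵥ σ (proj e y)) x := hcσ.const_vadd g
      filter_upwards [(continuousAt_id.prodMk this).eventually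
        (isClosed_diagonal.isOpen_compl.mem_nhds hg)] with y hy hy'
      exact absurd hy' hy
  filter_upwards [hint, hsep] with y hy hyx
  obtain ⟨g, hg⟩ := exists_eq_vadd_section hσ hy
  rw [Bool.eq_iff_iff, sheet_eq_true_iff hσ hfree hy hg,
    sheet_eq_true_iff hσ hfree hx (hyx g hg)]

/-- The sheet may jump near a point over ∂P, but the candidate images in both sheets tend to the
same glued point. -/
theorem continuous_toDouble (hσc : ContinuousOn σ (interior P)) :
    Continuous (toDouble e σ G) := by
  have hc : ∀ b : Bool, Continuous fun x : X => (Quotient.mk _ (proj e x, b) : Double P) := fun b =>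
    continuous_quotient_mk'.comp ((isOpenQuotientMap_proj e).continuous.prodMk continuous_const)
  refine continuous_iff_continuousAt.2 fun x => ?_
  by_cases hx : (proj e x : Euc n) ∈ interior P
  · refine ((hc (sheet e σ G x)).continuousAt).congr ?_
    filter_upwards [eventually_sheet_eq hσ hfree hσc hx] with y hy
    rw [toDouble, hy]
  · have hfr : (proj e x : Euc n) ∈ frontier P := ⟨subset_closure (proj e x).2, hx⟩
    have heq : ∀ b, (Quotient.mk _ (proj e x, b) : Double P) = toDouble e σ G x := fun b =>
      Double.mk_eq_mk.2 ⟨rfl, Or.inr hfr⟩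
    intro U hU
    have hU' : ∀ b, ∀ᶠ y in 𝓝 x, (Quotient.mk _ (proj e y, b) : Double P) ∈ U := fun b =>
      (hc b).continuousAt (by rw [heq b]; exact hU)
    refine Filter.mem_map.2 ?_
    filter_upwards [hU' true, hU' false] with y h1 h2
    change toDouble e σ G y ∈ U
    rw [toDouble]
    cases sheet e σ G y
    exacts [h2, h1]

variable (hG : G.index = 2)
  (hbd : ∀ x : X, (proj e x : Euc n) ∉ interior P → ∃ g : TwoTorus n, g ∉ G ∧ g +ᵥ x = x)

include hG hbd

omit [T2Space X] [ContinuousConstVAdd (TwoTorus n) X] in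
-- Over the interior, translation by t preserves the sheet exactly when t ∈ G. Over the boundary, a
-- t outside G is corrected by a stabilizer element s outside G: t + s ∈ G by index 2, and it acts
-- on y as t does.
theorem toDouble_eq_iff {x y : X} :
    toDouble e σ G x = toDouble e σ G y ↔ AddAction.orbitRel G X x y := by
  rw [toDouble, toDouble, Double.mk_eq_mk]
  dsimp only
  constructor
  · rintro ⟨h1, h2⟩
    obtain ⟨t, rfl⟩ := (proj_eq_iff e).1 h1
    by_cases hx : (proj e y : Euc n) ∈ interior P
    · have h3 := h2.resolve_right (by rw [h1]; exact fun h => h.2 hx)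
      obtain ⟨h, hh⟩ := exists_eq_vadd_section hσ hx
      have hth : t +ᵥ y = (t + h) +ᵥ σ (proj e (t +ᵥ y)) := by rw [add_vadd, h1, ← hh]
      rw [Bool.eq_iff_iff, sheet_eq_true_iff hσ hfree hx hh,
        sheet_eq_true_iff hσ hfree (by rwa [h1]) hth, AddSubgroup.add_mem_iff_of_index_two hG] at h3
      exact ⟨⟨t, by tauto⟩, rfl⟩
    · by_cases ht : t ∈ G
      · exact ⟨⟨t, ht⟩, rfl⟩
      · obtain ⟨s, hs, hsy⟩ := hbd y hx
        refine ⟨⟨t + s, by rw [AddSubgroup.add_mem_iff_of_index_two hG]; tauto⟩, ?_⟩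
        change (t + s) +ᵥ y = t +ᵥ y
        rw [add_vadd, hsy]
  · rintro ⟨⟨t, ht⟩, rfl⟩
    have h1 : proj e (t +ᵥ y) = proj e y := proj_vadd t y
    refine ⟨h1, ?_⟩
    change sheet e σ G (t +ᵥ y) = sheet e σ G y ∨ (proj e (t +ᵥ y) : Euc n) ∈ frontier P
    rw [h1]
    by_cases hx : (proj e y : Euc n) ∈ interior P
    · left
      obtain ⟨h, hh⟩ := exists_eq_vadd_section hσ hx
      have hth : t +ᵥ y = (t + h) +ᵥ σ (proj e (t +ᵥ y)) := by rw [add_vadd, h1, ← hh]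
      rw [Bool.eq_iff_iff, sheet_eq_true_iff hσ hfree hx hh,
        sheet_eq_true_iff hσ hfree (by rwa [h1]) hth, AddSubgroup.add_mem_iff_of_index_two hG]
      tauto
    · exact Or.inr ⟨subset_closure (proj e y).2, hx⟩

omit [T2Space X] hbd in
theorem surjective_toDouble : Function.Surjective (toDouble e σ G) := by
  rintro ⟨p, b⟩
  by_cases hp : (p : Euc n) ∈ interior P
  · obtain ⟨t, ht⟩ : ∃ t : TwoTorus n, t ∈ G ↔ b = true := by
      cases b
      · obtain ⟨a, ha⟩ := SetLike.exists_not_mem_of_ne_top G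
          (fun h => by rw [h, AddSubgroup.index_top] at hG; omega)
        exact ⟨a, by simpa using ha⟩
      · exact ⟨0, by simp⟩
    have h1 : proj e (t +ᵥ σ p) = p := by
      rw [proj_vadd]
      exact Subtype.ext (hσ p hp)
    refine ⟨t +ᵥ σ p, Double.mk_eq_mk.2 ⟨h1, Or.inl ?_⟩⟩
    have h2 := sheet_eq_true_iff (G := G) hσ hfree (x := t +ᵥ σ p) (by rwa [h1]) (by rw [h1])
    exact Bool.eq_iff_iff.2 (h2.trans ht)
  · obtain ⟨x, rfl⟩ := (isOpenQuotientMap_proj e).surjective p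
    exact ⟨x, Double.mk_eq_mk.2 ⟨rfl, Or.inr ⟨subset_closure (proj e x).2, hp⟩⟩⟩

end

/-- The orbit space of a subgroup of index two is the double of the polytope, provided that the
whole group acts freely over the interior, and that all stabilizers over the boundary are
transverse to the subgroup. -/
theorem exists_homeomorph_double [LocallyCompactSpace X] (hc : Convex ℝ P) (hP : IsCompact P)
    (hne : (interior P).Nonempty) {G : AddSubgroup (TwoTorus n)} (hG : G.index = 2)
    (hfree : ∀ x : X, (proj e x : Euc n) ∈ interior P → ∀ g : TwoTorus n, g +ᵥ x = x → g = 0)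
    (hbd : ∀ x : X, (proj e x : Euc n) ∉ interior P → ∃ g : TwoTorus n, g ∉ G ∧ g +ᵥ x = x) :
    ∃ h : AddAction.orbitRel.Quotient G X ≃ₜ Double P,
      ∀ x : X, Double.fold (h (Quotient.mk _ x)) = proj e x := by
  obtain ⟨σ, hσc, hσ⟩ := exists_section (e := e) hc hne hfree
  have hiff : ∀ x y : X, toDouble e σ G x = toDouble e σ G y ↔ AddAction.orbitRel G X x y :=
    fun x y => toDouble_eq_iff hσ hfree hG hbd
  have : CompactSpace P := isCompact_iff_compactSpace.1 hP
  have : CompactSpace X := ⟨(isProperMap_proj e).isCompact_preimage (isCompact_univ (X := P))⟩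
  have : CompactSpace (AddAction.orbitRel.Quotient G X) := Quotient.compactSpace
  let f : AddAction.orbitRel.Quotient G X → Double P :=
    Quotient.lift (toDouble e σ G) fun x y => (hiff x y).2
  have hf : Continuous f := (continuous_toDouble hσ hfree hσc).quotient_lift _
  have hbij : Function.Bijective f := by
    refine ⟨?_, fun q => ?_⟩
    · rintro ⟨x⟩ ⟨y⟩ hxy
      exact Quotient.sound ((hiff x y).1 hxy)
    · obtain ⟨x, rfl⟩ := surjective_toDouble (e := e) hσ hfree hG q
      exact ⟨Quotient.mk _ x, rfl⟩
  exact ⟨Continuous.homeoOfEquivCompactToT2 (f := Equiv.ofBijective f hbij) hf, fun x => rfl⟩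

end OrbitSpace

end SmallCover

end

theorem theorem3 {n : ℕ} {X : Type*} [TopologicalSpace X] [T2Space X]
    [ChartedSpace (EuclideanSpace ℝ (Fin n)) X] [IsManifold (𝓡 n) ∞ X]
    [AddAction (SmallCover.TwoTorus n) X] (P : Set (EuclideanSpace ℝ (Fin n)))
    (e : AddAction.orbitRel.Quotient (SmallCover.TwoTorus n) X ≃ₜ P)
    (hX : SmallCover.IsSmallCover P e) (hor : SmallCover.IsOrientable n X)
    (G : AddSubgroup (SmallCover.TwoTorus n))
    (hG : SmallCover.IsSubtorusInGeneralPosition X G) :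
    Nonempty (AddAction.orbitRel.Quotient G X ≃ₜ
      Metric.sphere (0 : EuclideanSpace ℝ (Fin (n + 1))) 1) ∧
    ∃ h : AddAction.orbitRel.Quotient G X ≃ₜ SmallCover.Double P,
      ∀ x : X, SmallCover.Double.fold (h (Quotient.mk _ x)) = e (Quotient.mk _ x) := by
  have := hX.continuousConstVAdd
  have : LocallyCompactSpace X := ChartedSpace.locallyCompactSpace (EuclideanSpace ℝ (Fin n)) X
  have hpoly := hX.simple.1
  have hc : Convex ℝ P := by
    obtain ⟨⟨V, rfl⟩, -⟩ := hpoly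
    exact convex_convexHull ℝ _
  have hP : IsCompact P := by
    obtain ⟨⟨V, rfl⟩, -⟩ := hpoly
    exact V.finite_toSet.isCompact_convexHull (𝕜 := ℝ)
  obtain ⟨h, hh⟩ := SmallCover.exists_homeomorph_double (e := e) hc hP hpoly.2 hG.1
    (fun x hx g hg => hX.hasCornerCharts.eq_zero_of_vadd_eq_self hpoly hx hg)
    (fun x hx => hX.exists_notMem_vadd_eq_self hG hx)
  obtain ⟨k⟩ := SmallCover.nonempty_double_homeomorph_sphere hc hP hpoly.2
  exact ⟨⟨h.trans k⟩, h, hh⟩
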